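/- For a real number $z$ write $e(z)=e^{iz}$. Let $n\ge 1$, and let $\varphi:\mathbb R\to\mathbb R$ be smooth, integrable and nonnegative, with $\varphi(0)=1$ and $\operatorname{supp}\hat\varphi\subset[-1,1]$, where $\hat f(\xi)=\int f(y)\,e(-2\pi y\cdot\xi)\,dy$. For $R,D>0$ and $x=(x_1,\dots,x_n)\in\mathbb R^n$ put $$f_D(x)=e(2\pi R x_1)\,\varphi(R^{1/2}x_1)\prod_{j=2}^n\varphi(x_j)\sum_{\substack{l\in\mathbb Z\\ R/(2D)<l<R/D}}e(2\pi D l x_j),$$ and let $e^{it\hbar\Delta/2}f(x)=\int_{\mathbb R^n}\hat f(\xi)\,e(-\pi t|\xi|^2+2\pi x\cdot\xi)\,d\xi$, where $\hbar=1/(2\pi)$. For integers $p_1,\dots,p_n$ and $q>0$, call $(p_1/q,\dots,p_n/q)$ admissible if $\gcd(p_1,q)=1$ and, for $2\le j\le n$, all $p_j$ are even when $q\equiv 0 \pmod 4$ and all $p_j$ are odd when $q\equiv 2\pmod 4$ (no condition on these $p_j$ when $q$ is odd). There are constants $c_0,K,C>0$, depending only on $n$ and $\varphi$, such that the following holds for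 every $0<c\le c_0$. Let $R,D>0$ be such that at least one integer $l$ satisfies $R/(2D)<l<R/D$, let $q>0$ be an integer with $$\frac{R}{Dq}\ge K\sqrt{\ln q},$$ let $(p_1/q,\dots,p_n/q)$ be an admissible fraction such that $t:=\frac{2p_1}{D^2q}$ satisfies $0<t\le c_0/R$, and let $x\in[0,c]^n$ satisfy $$\Big|x_1-\frac{2p_1R}{qD^2}\Big|\le cR^{-1/2}\quad\text{and}\quad \Big|x_j-\frac{p_j}{Dq}\Big|\le cR^{-1}\quad(2\le j\le n).$$ Then $$\frac{|e^{it\hbar\Delta/2}f_D(x)|}{\|f_D\|_{L^2(\mathbb R^n)}}\ \ge\ C\,R^{1/4}\Big(\frac{R}{Dq}\Big)^{\frac{n-1}{2}}.$$ -/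

import Mathlib

open MeasureTheory
open scoped FourierTransform ContDiff

noncomputable section

/-- The convention `e(z) = exp(i z)`. -/
def e (z : ℝ) : ℂ := Complex.exp (Complex.I * (z : ℂ))

/-- The Schrödinger evolution `e^{i t ħ Δ / 2} f` with `ħ = 1 / (2π)`, that is
`∫ f̂(ξ) e(-π t |ξ|² + 2π x·ξ) dξ`, where `f̂(ξ) = ∫ f(y) e(-2π y·ξ) dy`. -/
def schrodinger {n : ℕ} (t : ℝ) (f : EuclideanSpace ℝ (Fin n) → ℂ)
    (x : EuclideanSpace ℝ (Fin n)) : ℂ :=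
  ∫ ξ : EuclideanSpace ℝ (Fin n),
    𝓕 f ξ * e (-Real.pi * t * ‖ξ‖ ^ 2 + 2 * Real.pi * inner ℝ x ξ)

/-- The `L²(ℝⁿ)` norm. -/
def normL2 {n : ℕ} (f : EuclideanSpace ℝ (Fin n) → ℂ) : ℝ :=
  (eLpNorm f 2 volume).toReal

/-- The profiles `φ`: smooth, integrable, nonnegative, with `supp φ̂` in the unit ball of `ℝ`
and `φ(0) = 1`. -/
structure IsProfile (φ : ℝ → ℝ) : Prop where
  smooth : ContDiff ℝ ∞ φ
  integrable : Integrable φ volume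
  nonneg : ∀ x, 0 ≤ φ x
  supp_fourier : tsupport (𝓕 (fun x : ℝ => (φ x : ℂ))) ⊆ Metric.closedBall 0 1
  map_zero : φ 0 = 1

/-- The first factor `f₁(x₁) = e(2π R x₁) φ(R^{1/2} x₁)`. -/
def datumFirst (φ : ℝ → ℝ) (R : ℝ) (y : ℝ) : ℂ :=
  e (2 * Real.pi * R * y) * (φ (Real.sqrt R * y) : ℂ)

/-- The integers `l` with `R / (2D) < l < R / D`. -/
def freqs (R D : ℝ) : Finset ℤ := Finset.Ioo ⌊R / (2 * D)⌋ ⌈R / D⌉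

theorem mem_freqs (R D : ℝ) (l : ℤ) :
    l ∈ freqs R D ↔ R / (2 * D) < (l : ℝ) ∧ (l : ℝ) < R / D := by
  rw [freqs, Finset.mem_Ioo, Int.floor_lt, Int.lt_ceil]

/-- One of the remaining factors, `φ(x_j) ∑_{R/(2D) < l < R/D} e(2π D l x_j)`. -/
def datumOther (φ : ℝ → ℝ) (R D : ℝ) (y : ℝ) : ℂ :=
  (φ y : ℂ) * ∑ l ∈ freqs R D, e (2 * Real.pi * D * l * y)

/-- The modified Bourgain datum `f_D` on `ℝⁿ`, `n = m + 1`. The coordinate `x₁` of the usual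
numbering is `x 0`, and `x₂, …, xₙ` are the `x j.succ`, `j : Fin m`. -/
def bourgainDatum {m : ℕ} (φ : ℝ → ℝ) (R D : ℝ) (x : EuclideanSpace ℝ (Fin (m + 1))) : ℂ :=
  datumFirst φ R (x 0) * ∏ j : Fin m, datumOther φ R D (x j.succ)

/-- Admissibility of the fraction `(p₁/q, …, pₙ/q)`, `n = m + 1`, where `p₁ = p 0`. -/
structure IsAdmissible {m : ℕ} (p : Fin (m + 1) → ℤ) (q : ℕ) : Prop where
  coprime : IsCoprime (p 0) (q : ℤ)
  even : q % 4 = 0 → ∀ j : Fin m, Even (p j.succ)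
  odd : q % 4 = 2 → ∀ j : Fin m, Odd (p j.succ)

/-- The slab of `E_{q,D}` attached to the fraction `(p₁/q, …, pₙ/q)`. -/
def slab {m : ℕ} (c R D : ℝ) (q : ℕ) (p : Fin (m + 1) → ℤ) :
    Set (EuclideanSpace ℝ (Fin (m + 1))) :=
  {x | |x 0 - 2 * (p 0 * R / (q * D ^ 2))| ≤ c * R ^ (-(1 / 2) : ℝ) ∧
    ∀ j : Fin m, |x j.succ - p j.succ / (D * q)| ≤ c * R⁻¹}

/-- The cube `[0, c]ⁿ`. -/
def cube {n : ℕ} (c : ℝ) : Set (EuclideanSpace ℝ (Fin n)) :=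
  {x | ∀ j, x j ∈ Set.Icc 0 c}

end

/-!
The datum is a tensor product, so both its Schrödinger evolution and its `L²` norm factor over the
coordinates (`schrodinger_euclidean_prod`, `normL2_euclidean_prod`).

Since `φ̂` is supported in `[-1, 1]` and has integral `φ 0 = 1`, integrating against it a function
that is nearly constant on `[-1, 1]` nearly returns that constant
(`IsProfile.norm_integral_hat_mul_sub_le`). After a change of variables the evolution of the first
factor is such an average of a slowly varying phase, hence of modulus at least `1 / 2`. That of any
other factor is such an average of exponential sums over the frequencies `l`. At the time
`t = 2 p₁ / (D² q)` these are the quadratic sums with phase `e (2π (-p₁ l² + pⱼ l) / q)`, up to a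
linear twist whose total variation over the frequencies is `O(c₀)`; summation by parts
(`norm_quadSum_twist_sub_le`) removes the twist.

A quadratic sum over about `R / D` consecutive integers consists of about `R / (D q)` complete
Gauss sums and one incomplete sum. Admissibility makes the modulus of the complete sums lie between
`√q` and `√(2 q)` (`norm_sq_quadSum_complete`), and Weyl differencing bounds the incomplete one by
`4 √(q log q)` (`norm_quadSum_le_of_lt`). The hypothesis `R / (D q) ≥ K √(log q)` is exactly what
makes the incomplete sum negligible, so the whole sum has size comparable with `R / (D √q)`.

For the norm, the restriction `0 < t ≤ c₀ / R` forces `D ≥ 4` (`four_le_of_time_le`), so the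
translates of `φ̂` by the frequencies `D l` are disjoint and the modulations of `φ` orthogonal.
Hence each of the other factors has squared norm equal to the number of frequencies, which is
comparable with `R / D`, times `‖φ‖₂²`. The quotient is then of order
`R^(1/4) ((R / (D √q)) / (R / D)^(1/2))^(n-1)`, as claimed.
-/

/-! ### The phase function -/

theorem e_add (a b : ℝ) : e (a + b) = e a * e b := by
  rw [e, e, e, ← Complex.exp_add]; push_cast; ring_nf

theorem e_zero : e 0 = 1 := by simp [e]

theorem norm_e (z : ℝ) : ‖e z‖ = 1 := by
  rw [e, mul_comm, Complex.norm_exp_ofReal_mul_I]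

theorem conj_e (z : ℝ) : (starRingEnd ℂ) (e z) = e (-z) := by
  rw [e, e, ← Complex.exp_conj]; simp

theorem continuous_e : Continuous e := by unfold e; fun_prop

theorem norm_e_sub_one_le (z : ℝ) : ‖e z - 1‖ ≤ |z| := by
  simpa [e] using Real.norm_exp_I_mul_ofReal_sub_one_le (x := z)

theorem norm_e_sub_one (z : ℝ) : ‖e z - 1‖ = 2 * |Real.sin (z / 2)| := by
  rw [e, Complex.norm_exp_I_mul_ofReal_sub_one]; simp

theorem e_two_pi_int (k : ℤ) : e (2 * Real.pi * k) = 1 := by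
  rw [e, Complex.exp_eq_one_iff]; exact ⟨k, by push_cast; ring⟩

theorem e_nat_mul (k : ℕ) (z : ℝ) : e (k * z) = e z ^ k := by
  rw [e, e, ← Complex.exp_nat_mul]; push_cast; ring_nf

theorem e_eq_of_sub_eq {a b : ℝ} (k : ℤ) (h : a = b + 2 * Real.pi * k) : e a = e b := by
  rw [h, e_add, e_two_pi_int, mul_one]

/-- By Jordan's inequality `‖e (2 π u / q) - 1‖` is at least `4 / q` times the smaller of `u` and
`q - u`, whose reciprocal is at most the sum of both reciprocals. -/
theorem two_div_norm_e_sub_one_le {u q : ℕ} (hu : 0 < u) (huq : u < q) :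
    2 / ‖e (2 * Real.pi * u / q) - 1‖ ≤ q / 2 * (1 / u + 1 / ((q : ℝ) - u)) := by
  have hu' : (0 : ℝ) < u := by exact_mod_cast hu
  have huq' : (u : ℝ) < q := by exact_mod_cast huq
  have hq : (0 : ℝ) < q := hu'.trans huq'
  have hv : (0 : ℝ) < (q : ℝ) - u := by linarith
  have key : ∀ v : ℝ, 0 < v → v ≤ q / 2 → (4 * v / q) ≤ 2 * |Real.sin (Real.pi * v / q)| := by
    intro v hv hvq
    have h1 : 2 / Real.pi * (Real.pi * v / q) ≤ Real.sin (Real.pi * v / q) := by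
      apply Real.mul_le_sin
      · positivity
      · rw [div_le_div_iff₀ hq two_pos]; nlinarith [Real.pi_pos]
    have h2 : 2 / Real.pi * (Real.pi * v / q) = 2 * v / q := by
      field_simp
    have h3 := le_abs_self (Real.sin (Real.pi * v / q))
    rw [h2] at h1
    have : 4 * v / q = 2 * (2 * v / q) := by ring
    linarith
  have hnorm : ‖e (2 * Real.pi * u / q) - 1‖ = 2 * |Real.sin (Real.pi * u / q)| := by
    rw [norm_e_sub_one]; congr 3; ring
  have step : ∀ v : ℝ, 0 < v → v ≤ q / 2 →
      2 * |Real.sin (Real.pi * u / q)| = 2 * |Real.sin (Real.pi * v / q)| →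
      2 / ‖e (2 * Real.pi * u / q) - 1‖ ≤ q / 2 * (1 / v) := by
    intro v hv hvq he
    rw [hnorm, he]
    calc 2 / (2 * |Real.sin (Real.pi * v / q)|) ≤ 2 / (4 * v / q) :=
          div_le_div_of_nonneg_left zero_le_two (by positivity) (key v hv hvq)
      _ = q / 2 * (1 / v) := by field_simp; norm_num
  rcases le_total (u : ℝ) (q / 2) with h | h
  · refine (step u hu' h rfl).trans ?_
    gcongr; have : 0 ≤ 1 / ((q : ℝ) - u) := by positivity
    linarith
  · refine (step (q - u) hv (by linarith) ?_).trans ?_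
    · have : Real.pi * (q - u) / q = Real.pi - Real.pi * u / q := by field_simp
      rw [this, Real.sin_pi_sub]
    · gcongr; have : 0 ≤ 1 / (u : ℝ) := by positivity
      linarith

/-! ### Quadratic exponential sums -/

/-- The quadratic phase `e (2π (-a l² + b l) / q)`. -/
noncomputable def quadPhase (a b : ℤ) (q : ℕ) (l : ℤ) : ℂ :=
  e (2 * Real.pi * (-(a * l ^ 2) + b * l) / q)

/-- The sum of the quadratic phase over the `N` consecutive integers from `L` on. -/
noncomputable def quadSum (a b : ℤ) (q : ℕ) (L : ℤ) (N : ℕ) : ℂ :=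
  ∑ k ∈ Finset.range N, quadPhase a b q (L + k)

theorem norm_quadPhase (a b : ℤ) (q : ℕ) (l : ℤ) : ‖quadPhase a b q l‖ = 1 := norm_e _

theorem quadPhase_periodic (a b : ℤ) {q : ℕ} (hq : 0 < q) (l : ℤ) :
    quadPhase a b q (l + q) = quadPhase a b q l := by
  have hq' : (q : ℝ) ≠ 0 := by positivity
  refine e_eq_of_sub_eq (-(a * (2 * l + q)) + b) ?_
  push_cast; field_simp; ring

/-- The differencing identity: the product is a linear phase in `l`. -/
theorem quadPhase_add_mul_conj (a b : ℤ) (q : ℕ) (l : ℤ) (h : ℤ) :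
    quadPhase a b q (l + h) * (starRingEnd ℂ) (quadPhase a b q l) =
      quadPhase a b q h * e (2 * Real.pi * (-(2 * a * h) * l) / q) := by
  rw [quadPhase, quadPhase, quadPhase, conj_e, ← e_add, ← e_add]
  congr 1; push_cast; ring

theorem quadSum_succ (a b : ℤ) (q : ℕ) (L : ℤ) (N : ℕ) :
    quadSum a b q L (N + 1) = quadSum a b q L N + quadPhase a b q (L + N) := by
  rw [quadSum, Finset.sum_range_succ, quadSum]

theorem quadSum_add (a b : ℤ) (q : ℕ) (L : ℤ) (M N : ℕ) :
    quadSum a b q L (M + N) = quadSum a b q L M + quadSum a b q (L + M) N := by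
  simp only [quadSum, Finset.sum_range_add]
  congr 1
  refine Finset.sum_congr rfl fun k _ => ?_
  push_cast; rw [add_assoc]

theorem quadSum_shift (a b : ℤ) {q : ℕ} (hq : 0 < q) (L : ℤ) (N : ℕ) (j : ℕ) :
    quadSum a b q (L + j * q) N = quadSum a b q L N := by
  induction j with
  | zero => simp
  | succ j ih =>
    rw [← ih]
    refine Finset.sum_congr rfl fun k _ => ?_
    rw [← quadPhase_periodic a b hq (L + j * q + k)]
    congr 1; push_cast; ring

theorem quadSum_mul_add (a b : ℤ) {q : ℕ} (hq : 0 < q) (L : ℤ) (j r : ℕ) :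
    quadSum a b q L (j * q + r) = j * quadSum a b q L q + quadSum a b q L r := by
  rw [quadSum_add]
  congr 1
  · induction j with
    | zero => simp [quadSum]
    | succ j ih =>
      rw [Nat.succ_mul, quadSum_add, ih]
      have := quadSum_shift a b hq L q j
      push_cast; rw [this]; ring
  · have := quadSum_shift a b hq L r j
    push_cast; exact this

theorem quadSum_complete_eq (a b : ℤ) {q : ℕ} (hq : 0 < q) (L : ℤ) :
    quadSum a b q L q = quadSum a b q 0 q := by
  have step : ∀ M : ℤ, quadSum a b q (M + 1) q = quadSum a b q M q := by
    intro M
    have h1 := quadSum_add a b q M 1 q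
    have h2 := quadSum_succ a b q M q
    rw [quadPhase_periodic a b hq] at h2
    rw [add_comm 1 q, h2] at h1
    have h3 : quadSum a b q M 1 = quadPhase a b q M := by simp [quadSum]
    rw [h3] at h1
    push_cast at h1
    linear_combination -h1
  induction L using Int.induction_on with
  | zero => rfl
  | succ i ih => rw [step, ih]
  | pred i ih => rw [← ih, ← step (-i - 1)]; simp

/-- Orthogonality of the additive characters modulo `q`. -/
theorem sum_e_eq (q : ℕ) (hq : 0 < q) (u : ℤ) :
    ∑ k ∈ Finset.range q, e (2 * Real.pi * (u * k) / q) = if (q : ℤ) ∣ u then (q : ℂ) else 0 := by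
  have hq' : (q : ℝ) ≠ 0 := by positivity
  have hpow : ∀ k : ℕ, e (2 * Real.pi * (u * k) / q) = e (2 * Real.pi * u / q) ^ k := by
    intro k; rw [← e_nat_mul]; congr 1; ring
  simp only [hpow]
  split_ifs with h
  · obtain ⟨v, rfl⟩ := h
    have : e (2 * Real.pi * ((q * v : ℤ) : ℝ) / q) = 1 := by
      rw [← e_two_pi_int v]; congr 1; push_cast; field_simp
    simp only [this, one_pow, Finset.sum_const, Finset.card_range, nsmul_eq_mul, mul_one]
  · have hne : e (2 * Real.pi * u / q) ≠ 1 := by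
      intro h1
      rw [e, Complex.exp_eq_one_iff] at h1
      obtain ⟨n, hn⟩ := h1
      apply h
      refine ⟨n, ?_⟩
      have h2 : (2 * Real.pi * u / q : ℝ) = 2 * Real.pi * n := by
        have h3 : Complex.I * ((2 * Real.pi * u / q : ℝ) : ℂ) =
            Complex.I * ((2 * Real.pi * n : ℝ) : ℂ) := by
          rw [hn]; push_cast; ring
        exact_mod_cast mul_left_cancel₀ Complex.I_ne_zero h3
      have hpi := Real.pi_pos.ne'
      field_simp at h2
      exact_mod_cast h2
    rw [geom_sum_eq hne, ← hpow]
    have : e (2 * Real.pi * (u * (q : ℕ)) / q) = 1 := by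
      rw [← e_two_pi_int u]; congr 1; field_simp
    rw [this]; simp

theorem dvd_two_mul_of_dvd {a : ℤ} {q : ℕ} (ha : IsCoprime a q) {h : ℤ}
    (hd : (q : ℤ) ∣ -(2 * a * h)) : (q : ℤ) ∣ 2 * h := by
  have : (q : ℤ) ∣ a * (2 * h) := by
    rwa [dvd_neg, mul_comm 2 a, mul_assoc] at hd
  exact (ha.symm).dvd_of_dvd_mul_left this

theorem normSq_quadSum_complete (a b : ℤ) {q : ℕ} (hq : 0 < q) :
    quadSum a b q 0 q * (starRingEnd ℂ) (quadSum a b q 0 q) =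
      ∑ h ∈ Finset.range q, if (q : ℤ) ∣ -(2 * a * h) then quadPhase a b q h * q else 0 := by
  have h1 : (starRingEnd ℂ) (quadSum a b q 0 q) =
      ∑ k ∈ Finset.range q, (starRingEnd ℂ) (quadPhase a b q k) := by
    simp [quadSum]
  rw [h1, Finset.mul_sum]
  have h2 : ∀ k : ℕ, quadSum a b q 0 q * (starRingEnd ℂ) (quadPhase a b q k) =
      ∑ h ∈ Finset.range q, quadPhase a b q h * e (2 * Real.pi * ((-(2 * a * h) : ℤ) * k) / q) := by
    intro k
    rw [← quadSum_complete_eq a b hq k, quadSum, Finset.sum_mul]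
    refine Finset.sum_congr rfl fun h _ => ?_
    rw [quadPhase_add_mul_conj]; push_cast; rfl
  simp only [h2]
  rw [Finset.sum_comm]
  refine Finset.sum_congr rfl fun h _ => ?_
  rw [← Finset.mul_sum, sum_e_eq q hq]
  split_ifs <;> simp

/-- Complete quadratic Gauss sums: the squared modulus is `q` for odd `q` and `2 q` for even `q`,
the parity conditions on `b` excluding the cancellation of the two diagonal terms. -/
theorem norm_sq_quadSum_complete (a b : ℤ) {q : ℕ} (hq : 0 < q) (ha : IsCoprime a q)
    (heven : q % 4 = 0 → Even b) (hodd : q % 4 = 2 → Odd b) :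
    (q : ℝ) ≤ ‖quadSum a b q 0 q‖ ^ 2 ∧ ‖quadSum a b q 0 q‖ ^ 2 ≤ 2 * q := by
  have h0 := normSq_quadSum_complete a b hq
  rw [Complex.mul_conj, Complex.normSq_eq_norm_sq] at h0
  have hdvd : ∀ h ∈ Finset.range q, (q : ℤ) ∣ -(2 * a * h) → h = 0 ∨ 2 * h = q := by
    intro h hh hd
    rw [Finset.mem_range] at hh
    obtain ⟨c, hc⟩ := dvd_two_mul_of_dvd ha hd
    have hc0 : 0 ≤ c := by
      by_contra hcon
      have : (q : ℤ) * c < 0 := mul_neg_of_pos_of_neg (by exact_mod_cast hq) (by omega)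
      omega
    have hc2 : c < 2 := by
      by_contra hcon
      have : (q : ℤ) * 2 ≤ q * c := by
        apply mul_le_mul_of_nonneg_left (by omega) (by omega)
      omega
    interval_cases c <;> omega
  have hz : quadPhase a b q 0 = 1 := by simp [quadPhase, e_zero]
  rcases Nat.even_or_odd q with hev | hod
  · obtain ⟨r, hr⟩ := hev
    have hrpos : 0 < r := by omega
    have hsub : ({0, r} : Finset ℕ) ⊆ Finset.range q := by
      intro x hx; simp only [Finset.mem_insert, Finset.mem_singleton] at hx
      rw [Finset.mem_range]; omega
    rw [← Finset.sum_subset hsub, Finset.sum_pair (by omega)] at h0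
    · have hd : (q : ℤ) ∣ -(2 * a * r) := ⟨-a, by rw [hr]; push_cast; ring⟩
      have hph : quadPhase a b q (r : ℤ) = 1 := by
        have : ∃ k : ℤ, -(a * r) + b = 2 * k := by
          rcases Nat.even_or_odd r with ⟨s, hs⟩ | ⟨s, hs⟩
          · obtain ⟨v, hv⟩ := heven (by omega)
            exact ⟨-(a * s) + v, by rw [hs, hv]; push_cast; ring⟩
          · obtain ⟨v, hv⟩ := hodd (by omega)
            have haodd : Odd a := by
              rw [← Int.not_even_iff_odd]
              rintro ⟨w, hw⟩
              obtain ⟨x, y, hxy⟩ := ha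
              have : (2 : ℤ) * (x * w + y * r) = 1 := by
                rw [← hxy, hw, hr]; push_cast; ring
              omega
            obtain ⟨w, hw⟩ := haodd
            exact ⟨-(2 * w * s + w + s) + v, by rw [hs, hv, hw]; push_cast; ring⟩
        obtain ⟨k, hk⟩ := this
        have hk' : (-(a * r) + b : ℝ) = 2 * k := by exact_mod_cast hk
        have hr' : (r : ℝ) ≠ 0 := by positivity
        rw [quadPhase, ← e_two_pi_int k]
        congr 1
        rw [hr]; push_cast
        have : (-(a * (r : ℝ) ^ 2) + b * r) = r * (2 * k) := by rw [← hk']; ring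
        rw [this]; field_simp; ring
      rw [if_pos hd, hph] at h0
      simp only [Nat.cast_zero, mul_zero, neg_zero, dvd_zero, if_true, hz, one_mul] at h0
      have h1 : ‖quadSum a b q 0 q‖ ^ 2 = 2 * q := by
        have : ((‖quadSum a b q 0 q‖ ^ 2 : ℝ) : ℂ) = ((2 * q : ℝ) : ℂ) := by
          rw [h0]; push_cast; ring
        exact_mod_cast this
      rw [h1]; constructor
      · have : (0 : ℝ) ≤ q := by positivity
        linarith
      · rfl
    · intro h hh hn
      rw [if_neg]
      intro hd
      rcases hdvd h hh hd with h' | h' <;> apply hn <;>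
        simp only [Finset.mem_insert, Finset.mem_singleton] <;> omega
  · obtain ⟨r, hr⟩ := hod
    rw [Finset.sum_eq_single 0] at h0
    · simp only [Nat.cast_zero, mul_zero, neg_zero, dvd_zero, if_true, hz, one_mul] at h0
      have h1 : ‖quadSum a b q 0 q‖ ^ 2 = q := by exact_mod_cast h0
      rw [h1]; constructor
      · rfl
      · have : (0 : ℝ) ≤ q := by positivity
        linarith
    · intro h hh hn
      rw [if_neg]
      intro hd
      rcases hdvd h hh hd with h' | h' <;> omega
    · intro h; exact absurd (Finset.mem_range.2 hq) h

/-! ### Incomplete quadratic sums: Weyl differencing -/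

/-- Differencing: in the expansion of the squared modulus the pairs of indices are grouped by their
difference `h`. The factor `2` accounts for both signs of `h`. -/
theorem norm_sq_sum_le (g : ℕ → ℂ) (N : ℕ) :
    ‖∑ k ∈ Finset.range N, g k‖ ^ 2 ≤
      2 * ∑ h ∈ Finset.range N,
        ‖∑ j ∈ Finset.range (N - h), g (j + h) * (starRingEnd ℂ) (g j)‖ := by
  have key : ∀ M : ℕ, ‖∑ k ∈ Finset.range M, g k‖ ^ 2 ≤
      2 * (∑ m ∈ Finset.range M, ∑ j ∈ Finset.range (m + 1), g m * (starRingEnd ℂ) (g j)).re := by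
    intro M
    induction M with
    | zero => simp
    | succ M ih =>
      rw [Finset.sum_range_succ, Finset.sum_range_succ (n := M), Complex.add_re, mul_add,
        ← Finset.mul_sum, ← map_sum, Finset.sum_range_succ (n := M)]
      set S := ∑ k ∈ Finset.range M, g k
      have h1 : ‖S + g M‖ ^ 2 = ‖S‖ ^ 2 + ‖g M‖ ^ 2 + 2 * (g M * (starRingEnd ℂ) S).re := by
        rw [← Complex.normSq_eq_norm_sq, ← Complex.normSq_eq_norm_sq, ← Complex.normSq_eq_norm_sq,
          add_comm S, Complex.normSq_add]
        ring
      have h2 : (g M * (starRingEnd ℂ) (S + g M)).re =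
          (g M * (starRingEnd ℂ) S).re + ‖g M‖ ^ 2 := by
        rw [map_add, mul_add, Complex.add_re, Complex.mul_conj, Complex.ofReal_re,
          Complex.normSq_eq_norm_sq]
      rw [h1, h2]
      nlinarith [sq_nonneg ‖g M‖]
  refine (key N).trans ?_
  refine mul_le_mul_of_nonneg_left ?_ zero_le_two
  refine (Complex.re_le_norm _).trans ?_
  have hflip : ∑ m ∈ Finset.range N, ∑ j ∈ Finset.range (m + 1), g m * (starRingEnd ℂ) (g j) =
      ∑ h ∈ Finset.range N, ∑ j ∈ Finset.range (N - h), g (j + h) * (starRingEnd ℂ) (g j) := by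
    rw [← Finset.sum_range_diag_flip N fun h j => g (j + h) * (starRingEnd ℂ) (g j)]
    refine Finset.sum_congr rfl fun m _ => ?_
    rw [← Finset.sum_flip]
    refine Finset.sum_congr rfl fun k hk => ?_
    rw [Nat.sub_add_cancel (Nat.lt_succ_iff.1 (Finset.mem_range.1 hk))]
  rw [hflip]
  exact norm_sum_le _ _

/-- A majorant for the geometric sums of ratio `e (2 π u / q)` with at most `q` terms, as a
function of the residue `u`. -/
noncomputable def geomBound (q u : ℕ) : ℝ :=
  if u = 0 then q else q / 2 * (1 / u + 1 / ((q : ℝ) - u))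

theorem geomBound_nonneg {q u : ℕ} (hu : u < q) : 0 ≤ geomBound q u := by
  have : (u : ℝ) < q := by exact_mod_cast hu
  have h2 : (0 : ℝ) < q - u := by linarith
  unfold geomBound; split_ifs <;> positivity

theorem norm_geom_sum_le {q u M : ℕ} (hu : u < q) (hM : M ≤ q) :
    ‖∑ k ∈ Finset.range M, e (2 * Real.pi * u / q) ^ k‖ ≤ geomBound q u := by
  unfold geomBound
  split_ifs with h
  · refine (norm_sum_le _ _).trans ?_
    simp only [norm_pow, norm_e, one_pow, Finset.sum_const, Finset.card_range, nsmul_eq_mul,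
      mul_one]
    exact_mod_cast hM
  · by_cases hne : e (2 * Real.pi * u / q) = 1
    · exfalso
      have hu' : (0 : ℝ) < u := by exact_mod_cast Nat.pos_of_ne_zero h
      have huq : (u : ℝ) < q := by exact_mod_cast hu
      have hq := hu'.trans huq
      have h1 := norm_e_sub_one (2 * Real.pi * u / q)
      rw [hne, sub_self, norm_zero] at h1
      have h2 : 0 < Real.sin (2 * Real.pi * u / q / 2) := by
        apply Real.sin_pos_of_pos_of_lt_pi
        · have := Real.pi_pos; positivity
        · rw [div_div, div_lt_iff₀ (by positivity)]; nlinarith [Real.pi_pos]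
      have := abs_pos.2 h2.ne'
      linarith
    · rw [geom_sum_eq hne, norm_div]
      refine le_trans ?_ (two_div_norm_e_sub_one_le (Nat.pos_of_ne_zero h) hu)
      gcongr
      refine (norm_sub_le _ _).trans ?_
      rw [norm_pow, norm_e, one_pow, norm_one]; norm_num

theorem sum_geomBound_le {q : ℕ} (hq : 0 < q) :
    ∑ u ∈ Finset.range q, geomBound q u ≤ q * (2 + Real.log q) := by
  obtain ⟨n, rfl⟩ : ∃ n, q = n + 1 := ⟨q - 1, by omega⟩
  rw [Finset.sum_range_succ']
  have h1 : ∀ k : ℕ, geomBound (n + 1) (k + 1) =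
      ((n + 1 : ℕ) : ℝ) / 2 * (1 / ((k : ℝ) + 1) + 1 / ((n : ℝ) - k)) := by
    intro k; rw [geomBound, if_neg (by omega)]; push_cast; ring_nf
  have hH : ∑ k ∈ Finset.range n, 1 / ((k : ℝ) + 1) ≤ 1 + Real.log (n + 1 : ℕ) := by
    have h2 := harmonic_le_one_add_log n
    rw [harmonic] at h2; push_cast at h2
    have h3 : Real.log n ≤ Real.log (n + 1 : ℕ) := by
      rcases Nat.eq_zero_or_pos n with rfl | hn
      · simp
      · apply Real.log_le_log (by exact_mod_cast hn); push_cast; linarith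
    simp only [one_div]; push_cast at h3 ⊢; linarith
  have hR : ∑ k ∈ Finset.range n, 1 / ((n : ℝ) - k) = ∑ k ∈ Finset.range n, 1 / ((k : ℝ) + 1) := by
    rw [← Finset.sum_range_reflect]
    refine Finset.sum_congr rfl fun k hk => ?_
    rw [Finset.mem_range] at hk
    have : ((n - 1 - k : ℕ) : ℝ) = n - 1 - k := by
      rw [Nat.cast_sub (by omega), Nat.cast_sub (by omega)]; simp
    rw [this]; ring_nf
  simp only [h1]
  rw [← Finset.mul_sum, Finset.sum_add_distrib, hR]
  have h0 : geomBound (n + 1) 0 = ((n + 1 : ℕ) : ℝ) := by simp [geomBound]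
  rw [h0]
  have hp : (0 : ℝ) < ((n + 1 : ℕ) : ℝ) := by positivity
  nlinarith

/-- The residues `-2 a h` modulo `q`, for `h` running over half a period, are distinct; so over a
full period each residue is taken at most twice. -/
theorem sum_geomBound_residue_le {a : ℤ} {q : ℕ} (hq : 0 < q) (ha : IsCoprime a q) :
    ∑ h ∈ Finset.range q, geomBound q ((-(2 * a * h)) % (q : ℤ)).toNat ≤
      2 * ∑ u ∈ Finset.range q, geomBound q u := by
  have hqz : (q : ℤ) ≠ 0 := by omega
  set ρ : ℕ → ℕ := fun h => ((-(2 * a * h)) % (q : ℤ)).toNat with hρ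
  have hlt : ∀ h, ρ h < q := by
    intro h
    have h1 := Int.emod_lt_of_pos (-(2 * a * h)) (b := q) (by omega)
    simp only [hρ]; omega
  have half : ∀ s ⊆ Finset.range q, (∀ x ∈ s, ∀ y ∈ s, |2 * ((x : ℤ) - y)| < q) →
      ∑ h ∈ s, geomBound q (ρ h) ≤ ∑ u ∈ Finset.range q, geomBound q u := by
    intro s hs hd
    have hinj : Set.InjOn ρ s := by
      intro x hx y hy hxy
      have h1 := Int.emod_nonneg (-(2 * a * x)) hqz
      have h2 := Int.emod_nonneg (-(2 * a * y)) hqz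
      have h3 : (-(2 * a * x)) % (q : ℤ) = (-(2 * a * y)) % (q : ℤ) := by
        simp only [hρ] at hxy; omega
      have h4 : (q : ℤ) ∣ -(2 * a * (x - y)) := by
        have := Int.ModEq.dvd h3.symm
        convert this using 1; ring
      have h5 := Int.eq_zero_of_abs_lt_dvd (dvd_two_mul_of_dvd ha h4) (hd x hx y hy)
      omega
    rw [← Finset.sum_image (f := fun u => geomBound q u) hinj]
    refine Finset.sum_le_sum_of_subset_of_nonneg ?_ ?_
    · intro u hu
      obtain ⟨h, -, rfl⟩ := Finset.mem_image.1 hu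
      exact Finset.mem_range.2 (hlt h)
    · intro u hu _
      exact geomBound_nonneg (Finset.mem_range.1 hu)
  rw [← Finset.sum_filter_add_sum_filter_not (Finset.range q) (fun h : ℕ => 2 * h < q),
    two_mul (∑ u ∈ Finset.range q, geomBound q u)]
  refine add_le_add
    (half ((Finset.range q).filter fun h => 2 * h < q) (Finset.filter_subset _ _) ?_)
    (half ((Finset.range q).filter fun h => ¬2 * h < q) (Finset.filter_subset _ _) ?_)
  all_goals
    intro x hx y hy
    simp only [Finset.mem_filter, Finset.mem_range] at hx hy
    rw [abs_lt]
    omega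

/-- Weyl's inequality for incomplete quadratic sums, which loses only a logarithm compared with
the square-root size of the complete ones. -/
theorem norm_quadSum_le_of_lt {a : ℤ} (b : ℤ) {q : ℕ} (ha : IsCoprime a q) (L : ℤ)
    {r : ℕ} (hr : r < q) : ‖quadSum a b q L r‖ ≤ 4 * Real.sqrt (q * Real.log q) := by
  rcases Nat.eq_zero_or_pos r with rfl | hr0
  · simp only [quadSum, Finset.range_zero, Finset.sum_empty, norm_zero]; positivity
  have hq : 0 < q := by omega
  have hq' : (q : ℝ) ≠ 0 := by positivity
  have h1 := norm_sq_sum_le (fun k => quadPhase a b q (L + k)) r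
  have h2 : ∀ h ∈ Finset.range r,
      ‖∑ j ∈ Finset.range (r - h), quadPhase a b q (L + (j + h : ℕ)) *
        (starRingEnd ℂ) (quadPhase a b q (L + j))‖ ≤
      geomBound q ((-(2 * a * h)) % (q : ℤ)).toNat := by
    intro h hh
    set u := ((-(2 * a * h)) % (q : ℤ)).toNat with hu
    have hm := Int.emod_lt_of_pos (-(2 * a * h)) (b := q) (by omega)
    have hm0 := Int.emod_nonneg (-(2 * a * h)) (b := (q : ℤ)) (by omega)
    have hdm := Int.emod_add_mul_ediv (-(2 * a * h)) q
    have huz : (u : ℤ) = (-(2 * a * h)) % (q : ℤ) := by omega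
    have h3 : ∀ j : ℕ, quadPhase a b q (L + (j + h : ℕ)) *
        (starRingEnd ℂ) (quadPhase a b q (L + j)) =
        (quadPhase a b q h * e (2 * Real.pi * (-(2 * a * h) * L) / q)) *
          e (2 * Real.pi * u / q) ^ j := by
      intro j
      have : L + ((j + h : ℕ) : ℤ) = (L + j) + (h : ℤ) := by push_cast; ring
      rw [this, quadPhase_add_mul_conj, mul_assoc (quadPhase a b q h), ← e_nat_mul, ← e_add]
      congr 1
      have hur : (-(2 * a * h) : ℝ) = u + q * ((-(2 * a * h)) / (q : ℤ) : ℤ) := by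
        rw [← huz] at hdm; exact_mod_cast hdm.symm
      refine e_eq_of_sub_eq (((-(2 * a * h)) / (q : ℤ)) * j) ?_
      push_cast
      have : 2 * Real.pi * (-(2 * a * h) * (L + j)) / q =
        2 * Real.pi * (-(2 * a * h) * L) / q + 2 * Real.pi * (-(2 * a * h)) * j / q := by ring
      rw [this, add_assoc, add_right_inj]
      conv_lhs => rw [hur]
      field_simp
    simp only [h3]
    rw [← Finset.mul_sum, norm_mul, norm_mul, norm_quadPhase, norm_e, one_mul, one_mul]
    exact norm_geom_sum_le (by omega) (by omega)
  have h3 : ‖quadSum a b q L r‖ ^ 2 ≤ 16 * (q * Real.log q) := by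
    have h4 : ∑ h ∈ Finset.range r, geomBound q ((-(2 * a * h)) % (q : ℤ)).toNat ≤
        ∑ h ∈ Finset.range q, geomBound q ((-(2 * a * h)) % (q : ℤ)).toNat := by
      refine Finset.sum_le_sum_of_subset_of_nonneg (Finset.range_mono hr.le) fun h _ _ => ?_
      have hm := Int.emod_lt_of_pos (-(2 * a * h)) (b := q) (by omega)
      exact geomBound_nonneg (by omega)
    have h5 := (Finset.sum_le_sum h2).trans
      (h4.trans ((sum_geomBound_residue_le hq ha).trans
        (mul_le_mul_of_nonneg_left (sum_geomBound_le hq) zero_le_two)))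
    have hlog : 0.69 ≤ Real.log q := by
      have : Real.log 2 ≤ Real.log q :=
        Real.log_le_log two_pos (by exact_mod_cast (by omega : 2 ≤ q))
      linarith [Real.log_two_gt_d9]
    have hqpos : (0 : ℝ) < q := by positivity
    have h6 : ‖quadSum a b q L r‖ ^ 2 ≤ 2 * (2 * (q * (2 + Real.log q))) :=
      h1.trans (mul_le_mul_of_nonneg_left h5 zero_le_two)
    nlinarith
  calc ‖quadSum a b q L r‖ = Real.sqrt (‖quadSum a b q L r‖ ^ 2) :=
        (Real.sqrt_sq (norm_nonneg _)).symm
    _ ≤ Real.sqrt (4 ^ 2 * (q * Real.log q)) := Real.sqrt_le_sqrt (by linarith)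
    _ = 4 * Real.sqrt (q * Real.log q) := by
        rw [Real.sqrt_mul (by norm_num), Real.sqrt_sq (by norm_num)]

/-! ### Quadratic sums of arbitrary length and slowly varying weights -/

theorem quadSum_complete_bounds (a b : ℤ) {q : ℕ} (hq : 0 < q) (ha : IsCoprime a q)
    (heven : q % 4 = 0 → Even b) (hodd : q % 4 = 2 → Odd b) (L : ℤ) :
    Real.sqrt q ≤ ‖quadSum a b q L q‖ ∧ ‖quadSum a b q L q‖ ≤ 2 * Real.sqrt q := by
  obtain ⟨h1, h2⟩ := norm_sq_quadSum_complete a b hq ha heven hodd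
  rw [quadSum_complete_eq a b hq]
  have hs := Real.sq_sqrt (Nat.cast_nonneg (α := ℝ) q)
  have hs0 := Real.sqrt_nonneg (q : ℝ)
  constructor
  · exact Real.sqrt_le_iff.2 ⟨norm_nonneg _, h1⟩
  · refine abs_le_of_sq_le_sq' ?_ (by positivity) |>.2
    rw [mul_pow, hs]; linarith [Nat.cast_nonneg (α := ℝ) q]

theorem norm_quadSum_le (a b : ℤ) {q : ℕ} (hq : 0 < q) (ha : IsCoprime a q)
    (heven : q % 4 = 0 → Even b) (hodd : q % 4 = 2 → Odd b) (L : ℤ) (N : ℕ) :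
    ‖quadSum a b q L N‖ ≤ 2 * (N / Real.sqrt q) + 4 * Real.sqrt (q * Real.log q) := by
  have hN := Nat.div_add_mod' N q
  rw [← hN, quadSum_mul_add a b hq, hN]
  refine (norm_add_le _ _).trans (add_le_add ?_ (norm_quadSum_le_of_lt b ha L (Nat.mod_lt _ hq)))
  rw [norm_mul, Complex.norm_natCast]
  have hq' : (0 : ℝ) < q := by exact_mod_cast hq
  have hs : 0 < Real.sqrt q := Real.sqrt_pos.2 hq'
  have h1 : ((N / q : ℕ) : ℝ) ≤ N / q := Nat.cast_div_le
  calc ((N / q : ℕ) : ℝ) * ‖quadSum a b q L q‖ ≤ N / q * (2 * Real.sqrt q) :=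
        mul_le_mul h1 (quadSum_complete_bounds a b hq ha heven hodd L).2 (norm_nonneg _)
          (by positivity)
    _ = 2 * (N / Real.sqrt q) := by
        rw [div_mul_eq_mul_div, div_eq_iff hq'.ne']
        field_simp
        rw [Real.sq_sqrt hq'.le]

theorem le_norm_quadSum (a b : ℤ) {q : ℕ} (hq : 0 < q) (ha : IsCoprime a q)
    (heven : q % 4 = 0 → Even b) (hodd : q % 4 = 2 → Odd b) (L : ℤ) (N : ℕ) :
    (N / q : ℕ) * Real.sqrt q - 4 * Real.sqrt (q * Real.log q) ≤ ‖quadSum a b q L N‖ := by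
  have h1 := quadSum_mul_add a b hq L (N / q) (N % q)
  rw [Nat.div_add_mod'] at h1
  have h2 := norm_quadSum_le_of_lt b ha L (Nat.mod_lt N hq)
  have h3 := norm_sub_le_norm_add ((N / q : ℕ) * quadSum a b q L q) (quadSum a b q L (N % q))
  rw [← h1, norm_mul, Complex.norm_natCast] at h3
  have h4 : ((N / q : ℕ) : ℝ) * Real.sqrt q ≤ (N / q : ℕ) * ‖quadSum a b q L q‖ := by
    gcongr; exact (quadSum_complete_bounds a b hq ha heven hodd L).1
  linarith

/-- Summation by parts: weights of small total variation do little harm to a sum with bounded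
partial sums. -/
theorem norm_sum_mul_sub_le (g w : ℕ → ℂ) (N : ℕ) {M v : ℝ}
    (hM : ∀ k ≤ N, ‖∑ i ∈ Finset.range k, g i‖ ≤ M) (hv : ∀ k, ‖w k - w (k + 1)‖ ≤ v) :
    ‖∑ k ∈ Finset.range N, g k * w k - (∑ k ∈ Finset.range N, g k) * w N‖ ≤ M * (N * v) := by
  have hM0 : 0 ≤ M := (norm_nonneg _).trans (hM 0 (Nat.zero_le _))
  induction N with
  | zero => simp
  | succ N ih =>
    have h1 : ∑ k ∈ Finset.range (N + 1), g k * w k -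
        (∑ k ∈ Finset.range (N + 1), g k) * w (N + 1) =
        (∑ k ∈ Finset.range N, g k * w k - (∑ k ∈ Finset.range N, g k) * w N) +
          (∑ k ∈ Finset.range (N + 1), g k) * (w N - w (N + 1)) := by
      rw [Finset.sum_range_succ, Finset.sum_range_succ]; ring
    rw [h1]
    refine (norm_add_le _ _).trans ?_
    have h2 := ih fun k hk => hM k (by omega)
    have h3 : ‖(∑ k ∈ Finset.range (N + 1), g k) * (w N - w (N + 1))‖ ≤ M * v := by
      rw [norm_mul]
      exact mul_le_mul (hM _ le_rfl) (hv N) (norm_nonneg _) hM0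
    push_cast; linarith

theorem norm_quadSum_twist_sub_le (a b : ℤ) (q : ℕ) (L : ℤ) (N : ℕ) {M θ : ℝ}
    (hM : ∀ k ≤ N, ‖quadSum a b q L k‖ ≤ M) :
    ‖∑ k ∈ Finset.range N, quadPhase a b q (L + k) * e ((L + k : ℤ) * θ) - quadSum a b q L N‖ ≤
      M * ((N + |((L + N : ℤ) : ℝ)|) * |θ|) := by
  have hv : ∀ k : ℕ, ‖e ((L + k : ℤ) * θ) - e ((L + (k + 1 : ℕ) : ℤ) * θ)‖ ≤ |θ| := by
    intro k
    have : e ((L + (k + 1 : ℕ) : ℤ) * θ) = e ((L + k : ℤ) * θ) * e θ := by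
      rw [← e_add]; congr 1; push_cast; ring
    rw [this, ← mul_one_sub, norm_mul, norm_e, one_mul, norm_sub_rev]
    exact norm_e_sub_one_le θ
  have h1 := norm_sum_mul_sub_le (fun k => quadPhase a b q (L + k))
    (fun k => e ((L + k : ℤ) * θ)) N hM hv
  have h2 : ‖quadSum a b q L N * e ((L + N : ℤ) * θ) - quadSum a b q L N‖ ≤
      M * (|((L + N : ℤ) : ℝ)| * |θ|) := by
    rw [← mul_sub_one, norm_mul]
    refine mul_le_mul (hM N le_rfl) ((norm_e_sub_one_le _).trans (abs_mul _ _).le)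
      (norm_nonneg _) ((norm_nonneg _).trans (hM N le_rfl))
  calc _ ≤ _ := norm_sub_le_norm_sub_add_norm_sub _ (quadSum a b q L N * e ((L + N : ℤ) * θ)) _
    _ ≤ M * (N * |θ|) + M * (|((L + N : ℤ) : ℝ)| * |θ|) := add_le_add h1 h2
    _ = _ := by ring

/-! ### Tensor products -/

theorem integral_euclidean_prod {n : ℕ} (F : Fin n → ℝ → ℂ) :
    ∫ x : EuclideanSpace ℝ (Fin n), ∏ i, F i (x i) = ∏ i, ∫ y, F i y := by
  rw [← integral_fintype_prod_volume_eq_prod,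
    ← (PiLp.volume_preserving_ofLp (Fin n)).integral_comp
      (MeasurableEquiv.toLp 2 (Fin n → ℝ)).symm.measurableEmbedding]

theorem integrable_euclidean_prod {n : ℕ} {F : Fin n → ℝ → ℂ} (hF : ∀ i, Integrable (F i)) :
    Integrable (fun x : EuclideanSpace ℝ (Fin n) => ∏ i, F i (x i)) :=
  (PiLp.volume_preserving_ofLp (Fin n)).integrable_comp_of_integrable
    (Integrable.fintype_prod hF)

theorem fourier_eq_integral_e {V : Type*} [NormedAddCommGroup V] [InnerProductSpace ℝ V]
    [MeasurableSpace V] [BorelSpace V] [FiniteDimensional ℝ V] (f : V → ℂ) (ξ : V) :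
    𝓕 f ξ = ∫ v, e (-2 * Real.pi * inner ℝ v ξ) * f v := by
  rw [Real.fourier_eq']
  simp only [e, smul_eq_mul, mul_comm Complex.I]

theorem fourier_real_eq_integral_e (g : ℝ → ℂ) (s : ℝ) :
    𝓕 g s = ∫ v, e (-2 * Real.pi * (v * s)) * g v := by
  rw [fourier_eq_integral_e]
  simp [mul_comm]

theorem e_sum {ι : Type*} (s : Finset ι) (z : ι → ℝ) : e (∑ i ∈ s, z i) = ∏ i ∈ s, e (z i) := by
  simp only [e, ← Complex.exp_sum]; push_cast; rw [Finset.mul_sum]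

theorem fourier_euclidean_prod {n : ℕ} (F : Fin n → ℝ → ℂ) (ξ : EuclideanSpace ℝ (Fin n)) :
    𝓕 (fun x : EuclideanSpace ℝ (Fin n) => ∏ i, F i (x i)) ξ = ∏ i, 𝓕 (F i) (ξ i) := by
  simp only [fourier_real_eq_integral_e]
  rw [fourier_eq_integral_e, ← integral_euclidean_prod]
  congr 1; ext v
  rw [PiLp.inner_apply, Finset.mul_sum, e_sum, ← Finset.prod_mul_distrib]
  simp [mul_comm]

/-- The one-dimensional Schrödinger evolution. -/
noncomputable def evolve (t : ℝ) (g : ℝ → ℂ) (x : ℝ) : ℂ :=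
  ∫ s : ℝ, 𝓕 g s * e (-Real.pi * t * s ^ 2 + 2 * Real.pi * (x * s))

theorem schrodinger_euclidean_prod {n : ℕ} (F : Fin n → ℝ → ℂ) (t : ℝ)
    (x : EuclideanSpace ℝ (Fin n)) :
    schrodinger t (fun y : EuclideanSpace ℝ (Fin n) => ∏ i, F i (y i)) x =
      ∏ i, evolve t (F i) (x i) := by
  simp only [evolve]
  rw [schrodinger, ← integral_euclidean_prod]
  congr 1; ext ξ
  rw [fourier_euclidean_prod, PiLp.inner_apply, EuclideanSpace.norm_sq_eq, Finset.mul_sum,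
    Finset.mul_sum, ← Finset.sum_add_distrib, e_sum, ← Finset.prod_mul_distrib]
  simp [mul_comm]

theorem normL2_euclidean_prod {n : ℕ} {F : Fin n → ℝ → ℂ} (hF : ∀ i, Continuous (F i))
    (hF2 : ∀ i, Integrable fun y => ‖F i y‖ ^ 2) :
    normL2 (fun x : EuclideanSpace ℝ (Fin n) => ∏ i, F i (x i)) ^ 2 =
      ∏ i, ∫ y, ‖F i y‖ ^ 2 := by
  set f : EuclideanSpace ℝ (Fin n) → ℂ := fun x => ∏ i, F i (x i) with hf
  have hcont : Continuous f := by
    refine continuous_finsetProd _ fun i _ => (hF i).comp ?_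
    fun_prop
  have hpt : ∀ x, ((‖f x‖ ^ 2 : ℝ) : ℂ) = ∏ i, ((‖F i (x i)‖ ^ 2 : ℝ) : ℂ) := by
    intro x
    rw [← Complex.ofReal_prod, hf, norm_prod, Finset.prod_pow]
  have hintC : Integrable fun x => ((‖f x‖ ^ 2 : ℝ) : ℂ) := by
    simp only [hpt]
    exact integrable_euclidean_prod (F := fun i y => ((‖F i y‖ ^ 2 : ℝ) : ℂ))
      fun i => (hF2 i).ofReal
  have hint : Integrable fun x => ‖f x‖ ^ 2 := by
    have := hintC.re
    simpa only [RCLike.re_to_complex, Complex.ofReal_re] using this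
  have hmem : MemLp f 2 := (memLp_two_iff_integrable_sq_norm hcont.aestronglyMeasurable).2 hint
  have h1 : normL2 f ^ 2 = ∫ x, ‖f x‖ ^ 2 := by
    rw [normL2, hmem.eLpNorm_eq_integral_rpow_norm two_ne_zero ENNReal.ofNat_ne_top]
    have h0 : 0 ≤ ∫ x, ‖f x‖ ^ 2 := integral_nonneg fun x => by positivity
    simp only [ENNReal.toReal_ofNat, Real.rpow_ofNat]
    rw [ENNReal.toReal_ofReal (by positivity), ← Real.rpow_natCast, ← Real.rpow_mul h0]
    norm_num
  rw [h1]
  have h2 : ((∫ x, ‖f x‖ ^ 2 : ℝ) : ℂ) = ((∏ i, ∫ y, ‖F i y‖ ^ 2 : ℝ) : ℂ) := by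
    rw [← integral_complex_ofReal]
    simp only [hpt, Complex.ofReal_prod]
    rw [integral_euclidean_prod fun i y => ((‖F i y‖ ^ 2 : ℝ) : ℂ)]
    refine Finset.prod_congr rfl fun i _ => ?_
    exact integral_complex_ofReal
  exact_mod_cast h2

/-! ### The profile and its Fourier transform -/

/-- The Fourier transform of a profile. -/
noncomputable def profileHat (φ : ℝ → ℝ) : ℝ → ℂ := 𝓕 (fun x : ℝ => (φ x : ℂ))

namespace IsProfile

variable {φ : ℝ → ℝ}

theorem continuous (hφ : IsProfile φ) : Continuous φ := hφ.smooth.continuous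

theorem integrable_ofReal (hφ : IsProfile φ) : Integrable fun x : ℝ => (φ x : ℂ) :=
  hφ.integrable.ofReal

theorem continuous_hat (hφ : IsProfile φ) : Continuous (profileHat φ) :=
  VectorFourier.fourierIntegral_continuous Real.continuous_fourierChar
    (by exact continuous_inner) hφ.integrable_ofReal

theorem norm_hat_le (hφ : IsProfile φ) (s : ℝ) : ‖profileHat φ s‖ ≤ ∫ y, φ y := by
  refine (VectorFourier.norm_fourierIntegral_le_integral_norm _ _ _ _ _).trans ?_
  refine (integral_congr_ae (Filter.Eventually.of_forall fun y => ?_)).le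
  simp [abs_of_nonneg (hφ.nonneg y)]

theorem hat_eq_zero (hφ : IsProfile φ) {s : ℝ} (hs : 1 < |s|) : profileHat φ s = 0 := by
  by_contra h
  have := hφ.supp_fourier (subset_tsupport _ h)
  rw [Metric.mem_closedBall, dist_zero_right, Real.norm_eq_abs] at this
  linarith

theorem hasCompactSupport_hat (hφ : IsProfile φ) : HasCompactSupport (profileHat φ) :=
  (isCompact_closedBall (0 : ℝ) 1).of_isClosed_subset (isClosed_tsupport _) hφ.supp_fourier

theorem integrable_hat (hφ : IsProfile φ) : Integrable (profileHat φ) :=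
  hφ.continuous_hat.integrable_of_hasCompactSupport hφ.hasCompactSupport_hat

theorem fourierInv_hat (hφ : IsProfile φ) : 𝓕⁻ (profileHat φ) = fun x : ℝ => (φ x : ℂ) :=
  (Complex.continuous_ofReal.comp hφ.continuous).fourierInv_fourier_eq hφ.integrable_ofReal
    hφ.integrable_hat

theorem fourier_hat_neg (hφ : IsProfile φ) (y : ℝ) :
    𝓕 (fun s => profileHat φ (-s)) y = φ y := by
  rw [← Real.fourierInv_eq_fourier_comp_neg, hφ.fourierInv_hat]

theorem integral_hat (hφ : IsProfile φ) : ∫ s, profileHat φ s = 1 := by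
  have h := congrFun hφ.fourierInv_hat 0
  rw [Real.fourierInv_eq] at h
  simpa [hφ.map_zero] using h

theorem le_bound (hφ : IsProfile φ) (y : ℝ) : φ y ≤ ∫ s, ‖profileHat φ s‖ := by
  have h := congrFun hφ.fourierInv_hat y
  have h1 : φ y = ‖(φ y : ℂ)‖ := by
    rw [Complex.norm_real, Real.norm_eq_abs, abs_of_nonneg (hφ.nonneg y)]
  rw [h1, ← h]
  exact VectorFourier.norm_fourierIntegral_le_integral_norm _ _ _ _ _

theorem integrable_sq (hφ : IsProfile φ) : Integrable fun y => φ y ^ 2 := by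
  simp only [pow_two]
  refine hφ.integrable.bdd_mul (c := ∫ s, ‖profileHat φ s‖) hφ.continuous.aestronglyMeasurable
    (Filter.Eventually.of_forall fun y => ?_)
  rw [Real.norm_eq_abs, abs_of_nonneg (hφ.nonneg y)]
  exact hφ.le_bound y

theorem integral_sq_pos (hφ : IsProfile φ) : 0 < ∫ y, φ y ^ 2 := by
  refine integral_pos_of_integrable_nonneg_nonzero (x := 0) (hφ.continuous.pow 2)
    hφ.integrable_sq (fun y => sq_nonneg _) ?_
  simp [hφ.map_zero]

/-- Averaging a function against `φ̂` nearly reproduces a constant to which the function is close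
on the support. -/
theorem norm_integral_hat_mul_sub_le (hφ : IsProfile φ) {F : ℝ → ℂ} (hF : Continuous F) {z : ℂ}
    {ε : ℝ} (h : ∀ η, |η| ≤ 1 → ‖F η - z‖ ≤ ε) :
    ‖(∫ η, profileHat φ η * F η) - z‖ ≤ 2 * (∫ y, φ y) * ε := by
  have h1 : Integrable fun η => profileHat φ η * F η :=
    (hφ.continuous_hat.mul hF).integrable_of_hasCompactSupport hφ.hasCompactSupport_hat.mul_right
  have h2 : (∫ η, profileHat φ η * F η) - z = ∫ η, profileHat φ η * (F η - z) := by
    simp only [mul_sub]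
    rw [integral_sub h1 (hφ.integrable_hat.mul_const z), integral_mul_const, hφ.integral_hat,
      one_mul]
  have h3 : ∫ η, profileHat φ η * (F η - z) =
      ∫ η in Set.Icc (-1) 1, profileHat φ η * (F η - z) := by
    refine (setIntegral_eq_integral_of_forall_compl_eq_zero fun η hη => ?_).symm
    rw [hφ.hat_eq_zero, zero_mul]
    rw [Set.mem_Icc, ← abs_le] at hη
    exact not_le.1 hη
  rw [h2, h3]
  have h4 := norm_setIntegral_le_of_norm_le_const (μ := volume) (s := Set.Icc (-1 : ℝ) 1)
    (f := fun η => profileHat φ η * (F η - z)) (C := (∫ y, φ y) * ε) (by simp) (fun η hη => ?_)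
  · refine h4.trans_eq ?_
    rw [Real.volume_real_Icc]; norm_num; ring
  · rw [norm_mul]
    exact mul_le_mul (hφ.norm_hat_le η) (h η (abs_le.2 hη)) (norm_nonneg _)
      ((norm_nonneg _).trans (hφ.norm_hat_le 0))

/-- Modulations of `φ` whose frequencies are more than `2` apart are orthogonal, because the
translates of `φ̂` by those frequencies have disjoint supports. -/
theorem integral_sq_mul_e_eq_zero (hφ : IsProfile φ) {w : ℝ} (hw : 2 < |w|) :
    ∫ y, ((φ y ^ 2 : ℝ) : ℂ) * e (2 * Real.pi * (w * y)) = 0 := by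
  have hg : Integrable fun y => (φ y : ℂ) * e (2 * Real.pi * (w * y)) := by
    refine hφ.integrable_ofReal.mul_bdd (c := 1)
      (continuous_e.comp (by fun_prop)).aestronglyMeasurable
      (Filter.Eventually.of_forall fun y => (norm_e _).le)
  have hh : Integrable fun s => profileHat φ (-s) := hφ.integrable_hat.comp_neg
  have h1 := VectorFourier.integral_fourierIntegral_smul_eq_flip (μ := volume) (ν := volume)
    (L := innerₗ ℝ) Real.continuous_fourierChar (by exact continuous_inner) hh hg
  have h2 : ∀ s, 𝓕 (fun y => (φ y : ℂ) * e (2 * Real.pi * (w * y))) s = profileHat φ (s - w) := by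
    intro s
    rw [profileHat, fourier_real_eq_integral_e, fourier_real_eq_integral_e]
    congr 1; ext y
    rw [mul_comm (φ y : ℂ), ← mul_assoc, ← e_add]
    congr 2; ring
  have h3 : (∫ y, ((φ y ^ 2 : ℝ) : ℂ) * e (2 * Real.pi * (w * y))) =
      ∫ s, profileHat φ (-s) * profileHat φ (s - w) := by
    calc _ = ∫ y, 𝓕 (fun s => profileHat φ (-s)) y * ((φ y : ℂ) * e (2 * Real.pi * (w * y))) := by
          congr 1; ext y; rw [hφ.fourier_hat_neg]; push_cast; ring
      _ = ∫ s, profileHat φ (-s) * 𝓕 (fun y => (φ y : ℂ) * e (2 * Real.pi * (w * y))) s := by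
          rw [flip_innerₗ] at h1; exact h1
      _ = _ := by simp only [h2]
  rw [h3]
  refine integral_eq_zero_of_ae (Filter.Eventually.of_forall fun s => ?_)
  rcases lt_or_ge 1 |s| with h | h
  · simp [hφ.hat_eq_zero (s := -s) (by simpa using h)]
  · have : 1 < |s - w| := by
      have := abs_sub_abs_le_abs_sub w s
      rw [abs_sub_comm] at this; linarith
    simp [hφ.hat_eq_zero this]

end IsProfile

/-! ### Evolution and norms of the one-dimensional factors -/

theorem fourier_datumFirst (φ : ℝ → ℝ) {R : ℝ} (hR : 0 < R) (s : ℝ) :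
    𝓕 (datumFirst φ R) s = (Real.sqrt R)⁻¹ * profileHat φ ((s - R) / Real.sqrt R) := by
  have hr : 0 < Real.sqrt R := Real.sqrt_pos.2 hR
  set r := Real.sqrt R
  rw [profileHat, fourier_real_eq_integral_e, fourier_real_eq_integral_e]
  have h := Measure.integral_comp_mul_left
    (fun v : ℝ => e (-2 * Real.pi * (v * ((s - R) / r))) * (φ v : ℂ)) r
  rw [abs_of_pos (inv_pos.2 hr), Complex.real_smul] at h
  rw [← h]
  congr 1; ext v
  rw [datumFirst, ← mul_assoc, ← e_add]
  congr 2; field_simp; ring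

/-- The evolution of the first factor, written on the support of `φ̂`. -/
theorem evolve_datumFirst (φ : ℝ → ℝ) {R : ℝ} (hR : 0 < R) (t x : ℝ) :
    evolve t (datumFirst φ R) x = e (-Real.pi * t * R ^ 2 + 2 * Real.pi * (x * R)) *
      ∫ η, profileHat φ η *
        e (-Real.pi * (t * R) * η ^ 2 + 2 * Real.pi * (Real.sqrt R * (x - t * R) * η)) := by
  have hr : 0 < Real.sqrt R := Real.sqrt_pos.2 hR
  have hrr : Real.sqrt R ^ 2 = R := Real.sq_sqrt hR.le
  set r := Real.sqrt R
  set k : ℝ → ℂ := fun η => profileHat φ η *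
    e (-Real.pi * t * (R + r * η) ^ 2 + 2 * Real.pi * (x * (R + r * η))) with hk
  have h1 : evolve t (datumFirst φ R) x = ∫ s, (r : ℂ)⁻¹ * k ((s - R) / r) := by
    rw [evolve]; congr 1; ext s
    rw [fourier_datumFirst φ hR, hk]
    have : R + r * ((s - R) / r) = s := by field_simp; ring
    simp only [this, mul_assoc, Complex.ofReal_inv]; rfl
  have h2 : ∫ s, k ((s - R) / r) = r * ∫ η, k η := by
    rw [integral_sub_right_eq_self (fun s => k (s / r)) R, Measure.integral_comp_div,
      abs_of_pos hr, Complex.real_smul]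
  rw [h1, integral_const_mul, h2, ← mul_assoc,
    inv_mul_cancel₀ (by exact_mod_cast hr.ne'), one_mul, ← integral_const_mul]
  congr 1; ext η
  have hphase : -Real.pi * t * (R + r * η) ^ 2 + 2 * Real.pi * (x * (R + r * η)) =
      (-Real.pi * t * R ^ 2 + 2 * Real.pi * (x * R)) +
        (-Real.pi * (t * R) * η ^ 2 + 2 * Real.pi * (r * (x - t * R) * η)) := by
    linear_combination (-Real.pi * t * η ^ 2) * hrr
  rw [mul_left_comm, ← e_add, ← hphase]

theorem IsProfile.integrable_modulated {φ : ℝ → ℝ} (hφ : IsProfile φ) {z : ℝ → ℝ}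
    (hz : Continuous z) : Integrable fun y => e (z y) * (φ y : ℂ) :=
  hφ.integrable_ofReal.bdd_mul (c := 1) (continuous_e.comp hz).aestronglyMeasurable
    (Filter.Eventually.of_forall fun _ => (norm_e _).le)

theorem fourier_datumOther {φ : ℝ → ℝ} (hφ : IsProfile φ) (R D s : ℝ) :
    𝓕 (datumOther φ R D) s = ∑ l ∈ freqs R D, profileHat φ (s - D * l) := by
  simp only [profileHat, fourier_real_eq_integral_e]
  rw [← integral_finsetSum _ fun l _ => hφ.integrable_modulated (by fun_prop)]
  congr 1; ext v
  rw [datumOther, Finset.mul_sum, Finset.mul_sum]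
  refine Finset.sum_congr rfl fun l _ => ?_
  rw [mul_left_comm, ← e_add, mul_comm]
  congr 2; ring

/-- The evolution of one of the remaining factors: a smooth average of exponential sums. -/
theorem evolve_datumOther {φ : ℝ → ℝ} (hφ : IsProfile φ) (R D t x : ℝ) :
    evolve t (datumOther φ R D) x = ∫ η, profileHat φ η *
      (e (-Real.pi * t * η ^ 2 + 2 * Real.pi * (x * η)) * ∑ l ∈ freqs R D,
        e (-Real.pi * t * (D * l) ^ 2 + 2 * Real.pi * (x * (D * l)) +
          -(2 * Real.pi * (t * (D * l) * η)))) := by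
  have hint : ∀ z : ℝ → ℝ, Continuous z → Integrable fun η => profileHat φ η * e (z η) :=
    fun z hz => (hφ.continuous_hat.mul (continuous_e.comp hz)).integrable_of_hasCompactSupport
      hφ.hasCompactSupport_hat.mul_right
  set G : ℤ → ℝ → ℂ := fun l η => profileHat φ η *
    e (-Real.pi * t * (η + D * l) ^ 2 + 2 * Real.pi * (x * (η + D * l))) with hG
  have hGint : ∀ l, Integrable (G l) := fun l => hint _ (by fun_prop)
  have h1 : ∀ s, 𝓕 (datumOther φ R D) s * e (-Real.pi * t * s ^ 2 + 2 * Real.pi * (x * s)) =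
      ∑ l ∈ freqs R D, G l (s - D * l) := by
    intro s
    rw [fourier_datumOther hφ, Finset.sum_mul]
    refine Finset.sum_congr rfl fun l _ => ?_
    simp only [hG, sub_add_cancel]
  have h2 : ∀ η, profileHat φ η *
      (e (-Real.pi * t * η ^ 2 + 2 * Real.pi * (x * η)) * ∑ l ∈ freqs R D,
        e (-Real.pi * t * (D * l) ^ 2 + 2 * Real.pi * (x * (D * l)) +
          -(2 * Real.pi * (t * (D * l) * η)))) = ∑ l ∈ freqs R D, G l η := by
    intro η
    rw [Finset.mul_sum, Finset.mul_sum]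
    refine Finset.sum_congr rfl fun l _ => ?_
    simp only [hG]
    rw [← e_add]
    congr 2; ring
  simp only [evolve, h1, h2]
  rw [integral_finsetSum _ fun l _ => (hGint l).comp_sub_right (D * l),
    integral_finsetSum _ fun l _ => hGint l]
  exact Finset.sum_congr rfl fun l _ => integral_sub_right_eq_self (G l) _

theorem sum_freqs (R D : ℝ) (f : ℤ → ℂ) :
    ∑ l ∈ freqs R D, f l =
      ∑ k ∈ Finset.range (freqs R D).card, f (⌊R / (2 * D)⌋ + 1 + k) := by
  have h1 : freqs R D =
      (Finset.range (freqs R D).card).map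
        (Nat.castEmbedding.trans (addLeftEmbedding (⌊R / (2 * D)⌋ + 1))) := by
    ext l
    simp only [freqs, Int.card_Ioo, Finset.mem_Ioo, Finset.mem_map, Finset.mem_range,
      Function.Embedding.trans_apply, Nat.castEmbedding_apply, addLeftEmbedding_apply]
    constructor
    · intro h; exact ⟨(l - (⌊R / (2 * D)⌋ + 1)).toNat, by omega, by omega⟩
    · rintro ⟨k, hk, rfl⟩; omega
  conv_lhs => rw [h1]
  rw [Finset.sum_map]; rfl

theorem continuous_datumFirst {φ : ℝ → ℝ} (hφ : IsProfile φ) (R : ℝ) :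
    Continuous (datumFirst φ R) := by
  unfold datumFirst
  exact (continuous_e.comp (by fun_prop)).mul
    (Complex.continuous_ofReal.comp (hφ.continuous.comp (by fun_prop)))

theorem continuous_datumOther {φ : ℝ → ℝ} (hφ : IsProfile φ) (R D : ℝ) :
    Continuous (datumOther φ R D) := by
  unfold datumOther
  exact (Complex.continuous_ofReal.comp hφ.continuous).mul
    (continuous_finsetSum _ fun l _ => continuous_e.comp (by fun_prop))

theorem norm_datumFirst_sq (φ : ℝ → ℝ) (R y : ℝ) :
    ‖datumFirst φ R y‖ ^ 2 = φ (Real.sqrt R * y) ^ 2 := by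
  rw [datumFirst, norm_mul, norm_e, one_mul, Complex.norm_real, Real.norm_eq_abs, sq_abs]

theorem integrable_norm_datumFirst_sq {φ : ℝ → ℝ} (hφ : IsProfile φ) {R : ℝ} (hR : 0 < R) :
    Integrable fun y => ‖datumFirst φ R y‖ ^ 2 := by
  simp only [norm_datumFirst_sq]
  exact hφ.integrable_sq.comp_mul_left' (Real.sqrt_pos.2 hR).ne'

theorem integral_norm_datumFirst_sq (φ : ℝ → ℝ) {R : ℝ} (hR : 0 < R) :
    ∫ y, ‖datumFirst φ R y‖ ^ 2 = (Real.sqrt R)⁻¹ * ∫ y, φ y ^ 2 := by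
  simp only [norm_datumFirst_sq]
  rw [Measure.integral_comp_mul_left (fun y => φ y ^ 2),
    abs_of_pos (inv_pos.2 (Real.sqrt_pos.2 hR)), smul_eq_mul]

theorem integrable_norm_datumOther_sq {φ : ℝ → ℝ} (hφ : IsProfile φ) (R D : ℝ) :
    Integrable fun y => ‖datumOther φ R D y‖ ^ 2 := by
  have h : ∀ y, ‖datumOther φ R D y‖ ^ 2 =
      ‖∑ l ∈ freqs R D, e (2 * Real.pi * D * l * y)‖ ^ 2 * φ y ^ 2 := by
    intro y
    rw [datumOther, norm_mul, Complex.norm_real, Real.norm_eq_abs, mul_pow, sq_abs, mul_comm]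
  simp only [h]
  refine hφ.integrable_sq.bdd_mul (c := ((freqs R D).card : ℝ) ^ 2) ?_
    (Filter.Eventually.of_forall fun y => ?_)
  · exact ((continuous_finsetSum _ fun l _ => continuous_e.comp
      (by fun_prop)).norm.pow 2).aestronglyMeasurable
  · rw [norm_pow, norm_norm]
    refine pow_le_pow_left₀ (norm_nonneg _) ((norm_sum_le _ _).trans ?_) 2
    simp [norm_e]

/-- For `D > 2` the modulations making up the factor are orthogonal. -/
theorem integral_norm_datumOther_sq {φ : ℝ → ℝ} (hφ : IsProfile φ) (R : ℝ) {D : ℝ} (hD : 2 < D) :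
    ∫ y, ‖datumOther φ R D y‖ ^ 2 = (freqs R D).card * ∫ y, φ y ^ 2 := by
  have h1 : ∀ y, ((‖datumOther φ R D y‖ ^ 2 : ℝ) : ℂ) = ∑ l ∈ freqs R D, ∑ l' ∈ freqs R D,
      ((φ y ^ 2 : ℝ) : ℂ) * e (2 * Real.pi * ((D * (l - l')) * y)) := by
    intro y
    rw [← Complex.normSq_eq_norm_sq, ← Complex.mul_conj, datumOther, map_mul, Complex.conj_ofReal,
      map_sum]
    rw [mul_mul_mul_comm, Finset.sum_mul_sum, Finset.mul_sum]
    refine Finset.sum_congr rfl fun l _ => ?_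
    rw [Finset.mul_sum]
    refine Finset.sum_congr rfl fun l' _ => ?_
    rw [conj_e, ← e_add]
    push_cast
    congr 1
    · ring
    · congr 1; ring
  have hint : ∀ l l' : ℤ, Integrable fun y =>
      ((φ y ^ 2 : ℝ) : ℂ) * e (2 * Real.pi * ((D * (l - l')) * y)) := by
    intro l l'
    exact hφ.integrable_sq.ofReal.mul_bdd (c := 1)
      (continuous_e.comp (by fun_prop)).aestronglyMeasurable
      (Filter.Eventually.of_forall fun _ => (norm_e _).le)
  have h2 : ((∫ y, ‖datumOther φ R D y‖ ^ 2 : ℝ) : ℂ) =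
      (((freqs R D).card * ∫ y, φ y ^ 2 : ℝ) : ℂ) := by
    rw [← integral_complex_ofReal]
    simp only [h1]
    rw [integral_finsetSum _ fun l _ => integrable_finsetSum _ fun l' _ => hint l l']
    have h3 : ∀ l ∈ freqs R D, ∫ y, ∑ l' ∈ freqs R D,
        ((φ y ^ 2 : ℝ) : ℂ) * e (2 * Real.pi * ((D * (l - l')) * y)) =
        ((∫ y, φ y ^ 2 : ℝ) : ℂ) := by
      intro l hl
      rw [integral_finsetSum _ fun l' _ => hint l l', Finset.sum_eq_single l]
      · simp only [sub_self, mul_zero, zero_mul, e_zero, mul_one]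
        exact integral_complex_ofReal
      · intro l' _ hne
        refine hφ.integral_sq_mul_e_eq_zero ?_
        have h4 : (1 : ℝ) ≤ |(l : ℝ) - l'| := by
          have : (1 : ℤ) ≤ |l - l'| := Int.one_le_abs (sub_ne_zero.2 hne.symm)
          exact_mod_cast this
        rw [abs_mul, abs_of_pos (by linarith)]
        nlinarith
      · intro h; exact absurd hl h
    rw [Finset.sum_congr rfl h3]
    simp
  exact_mod_cast h2

/-! ### Lower bounds for the evolved factors -/

theorem half_le_norm_evolve_datumFirst {φ : ℝ → ℝ} (hφ : IsProfile φ) {R t x c₀ : ℝ} (hR : 0 < R)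
    (hc : 12 * Real.pi * (∫ y, φ y) * c₀ ≤ 1) (ht : |t * R| ≤ c₀)
    (hx : Real.sqrt R * |x - t * R| ≤ c₀) :
    1 / 2 ≤ ‖evolve t (datumFirst φ R) x‖ := by
  rw [evolve_datumFirst φ hR, norm_mul, norm_e, one_mul]
  have hpi := Real.pi_pos
  have h := hφ.norm_integral_hat_mul_sub_le
    (F := fun η => e (-Real.pi * (t * R) * η ^ 2 +
      2 * Real.pi * (Real.sqrt R * (x - t * R) * η)))
    (continuous_e.comp (by fun_prop)) (z := 1) (ε := 3 * Real.pi * c₀) ?_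
  · have h2 := norm_sub_norm_le (1 : ℂ) (∫ η, profileHat φ η * e (-Real.pi * (t * R) * η ^ 2 +
      2 * Real.pi * (Real.sqrt R * (x - t * R) * η)))
    rw [norm_sub_rev, norm_one] at h2
    nlinarith
  · intro η hη
    refine (norm_e_sub_one_le _).trans ((abs_add_le _ _).trans ?_)
    have h1 : |-Real.pi * (t * R) * η ^ 2| ≤ Real.pi * c₀ := by
      rw [abs_mul, abs_mul, abs_neg, abs_of_pos hpi, abs_pow]
      have : |η| ^ 2 ≤ 1 := pow_le_one₀ (abs_nonneg _) hη
      calc Real.pi * |t * R| * |η| ^ 2 ≤ Real.pi * |t * R| * 1 := by gcongr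
        _ ≤ Real.pi * c₀ := by rw [mul_one]; gcongr
    have h2 : |2 * Real.pi * (Real.sqrt R * (x - t * R) * η)| ≤ 2 * Real.pi * c₀ := by
      rw [abs_mul, abs_of_pos (by positivity : 0 < 2 * Real.pi), abs_mul, abs_mul,
        abs_of_nonneg (Real.sqrt_nonneg _)]
      refine mul_le_mul_of_nonneg_left ?_ (by positivity)
      calc Real.sqrt R * |x - t * R| * |η| ≤ Real.sqrt R * |x - t * R| * 1 := by gcongr
        _ ≤ c₀ := by rw [mul_one]; exact hx
    linarith

/-- The number of frequencies is comparable with `R / D`, as soon as there is one of them. -/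
theorem card_freqs_bounds {R D : ℝ} (hR : 0 < R) (hD : 0 < D)
    (hl : ∃ l : ℤ, R / (2 * D) < (l : ℝ) ∧ (l : ℝ) < R / D) :
    1 < R / D ∧ R / D / 4 ≤ (freqs R D).card ∧ ((freqs R D).card : ℝ) ≤ 2 * (R / D) ∧
      |((⌊R / (2 * D)⌋ + 1 + ((freqs R D).card : ℕ) : ℤ) : ℝ)| ≤ 2 * (R / D) := by
  obtain ⟨l, hl1, hl2⟩ := hl
  have hhalf : R / (2 * D) = R / D / 2 := by field_simp
  have hcard : (freqs R D).card = (⌈R / D⌉ - ⌊R / (2 * D)⌋ - 1).toNat := by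
    rw [freqs, Int.card_Ioo]
  have ha := Int.floor_lt.2 hl1
  have hb := Int.lt_ceil.2 hl2
  have hl0 : 0 < l := by
    have : (0 : ℝ) < l := lt_of_le_of_lt (by positivity) hl1
    exact_mod_cast this
  have hX : 1 < R / D := lt_of_le_of_lt (by exact_mod_cast hl0) hl2
  have hcz : ((freqs R D).card : ℤ) = ⌈R / D⌉ - ⌊R / (2 * D)⌋ - 1 := by omega
  have hcr : ((freqs R D).card : ℝ) = ⌈R / D⌉ - ⌊R / (2 * D)⌋ - 1 := by exact_mod_cast hcz
  have h1 := Int.le_ceil (R / D)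
  have h2 := Int.ceil_lt_add_one (R / D)
  have h3 := Int.floor_le (R / (2 * D))
  have h4 := Int.lt_floor_add_one (R / (2 * D))
  have hone : (1 : ℝ) ≤ (freqs R D).card := by
    have : 1 ≤ (freqs R D).card := by omega
    exact_mod_cast this
  rw [hhalf] at *
  refine ⟨hX, ?_, by linarith, ?_⟩
  · by_cases h : R / D ≤ 4 <;> linarith
  · have : (⌊R / D / 2⌋ + 1 + ((freqs R D).card : ℕ) : ℤ) = ⌈R / D⌉ := by omega
    rw [this, abs_of_nonneg (by linarith)]
    linarith

/-- For times of the form `2 a / (D² q)` the exponential sums are quadratic sums with a linear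
twist that measures the distance from `x` to the fraction `b / (D q)`. -/
theorem sum_freqs_eq_quadPhase {R D : ℝ} (hD : 0 < D) {q : ℕ} (hq : 0 < q) (a b : ℤ) {t : ℝ}
    (ht : t = 2 * a / (D ^ 2 * q)) (x η : ℝ) :
    ∑ l ∈ freqs R D, e (-Real.pi * t * (D * l) ^ 2 + 2 * Real.pi * (x * (D * l)) +
        -(2 * Real.pi * (t * (D * l) * η))) =
      ∑ k ∈ Finset.range (freqs R D).card, quadPhase a b q (⌊R / (2 * D)⌋ + 1 + k) *
        e ((⌊R / (2 * D)⌋ + 1 + k : ℤ) * (2 * Real.pi * D * (x - b / (D * q) - t * η))) := by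
  have hq' : (q : ℝ) ≠ 0 := by positivity
  rw [sum_freqs]
  refine Finset.sum_congr rfl fun k _ => ?_
  rw [quadPhase, ← e_add]
  congr 1
  have h1 : t * D ^ 2 = 2 * a / q := by rw [ht]; field_simp
  generalize hl : ((⌊R / (2 * D)⌋ + 1 + k : ℤ) : ℝ) = l
  have h2 : 2 * Real.pi * D * (x - b / (D * q) - t * η) =
      2 * Real.pi * (D * x - D * t * η) - 2 * Real.pi * b / q := by field_simp; ring
  rw [h2]
  linear_combination (-Real.pi * l ^ 2) * h1

/-- The size of the quadratic sums for the frequencies of the datum. The hypothesis on `q` makes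
the logarithmic loss of Weyl's inequality harmless, and it provides many complete periods
when `q ≥ 2`. -/
theorem quadSum_freqs_bounds {R D : ℝ} (hR : 0 < R) (hD : 0 < D)
    (hl : ∃ l : ℤ, R / (2 * D) < (l : ℝ) ∧ (l : ℝ) < R / D) {q : ℕ} (hq : 0 < q)
    (hK : 64 * Real.sqrt (Real.log q) ≤ R / (D * q)) {a b : ℤ} (ha : IsCoprime a q)
    (heven : q % 4 = 0 → Even b) (hodd : q % 4 = 2 → Odd b) (L : ℤ) :
    R / D / Real.sqrt q / 16 ≤ ‖quadSum a b q L (freqs R D).card‖ ∧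
      ∀ k ≤ (freqs R D).card, ‖quadSum a b q L k‖ ≤ 5 * (R / D / Real.sqrt q) := by
  obtain ⟨hX, hN1, hN2, -⟩ := card_freqs_bounds hR hD hl
  rw [← div_div] at hK
  set X := R / D with hXdef
  set N := (freqs R D).card
  have hq' : (0 : ℝ) < q := by exact_mod_cast hq
  have hs : 0 < Real.sqrt q := Real.sqrt_pos.2 hq'
  have hss : Real.sqrt q * Real.sqrt q = q := Real.mul_self_sqrt hq'.le
  have hdiv : X / q * Real.sqrt q = X / Real.sqrt q := by
    rw [div_mul_eq_mul_div, div_eq_div_iff hq'.ne' hs.ne', mul_assoc, hss]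
  have hlog : 64 * Real.sqrt (q * Real.log q) ≤ X / Real.sqrt q := by
    rw [Real.sqrt_mul hq'.le]
    calc 64 * (Real.sqrt q * Real.sqrt (Real.log q)) =
        Real.sqrt q * (64 * Real.sqrt (Real.log q)) := by ring
      _ ≤ Real.sqrt q * (X / q) := by gcongr
      _ = X / Real.sqrt q := by rw [mul_comm, hdiv]
  have hlog0 := Real.sqrt_nonneg (q * Real.log q)
  constructor
  · have hblock : X / q / 8 ≤ (N / q : ℕ) := by
      rcases Nat.lt_or_ge q 2 with h | h
      · obtain rfl : q = 1 := by omega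
        rw [Nat.div_one, Nat.cast_one, div_one]; linarith
      · have h1 : Real.log 2 ≤ Real.log q := Real.log_le_log two_pos (by exact_mod_cast h)
        have h2 : (1 / 2 : ℝ) ≤ Real.sqrt (Real.log q) :=
          Real.le_sqrt_of_sq_le (by linarith [Real.log_two_gt_d9])
        have h3 : (8 : ℝ) ≤ X / q := by linarith
        have h4 : (N : ℝ) < ((N / q : ℕ) + 1) * q := by
          have := Nat.lt_div_mul_add (a := N) hq
          have h5 : N < (N / q + 1) * q := by rw [Nat.succ_mul]; exact this
          exact_mod_cast h5
        have h6 : X / 4 / q < (N / q : ℕ) + 1 := by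
          rw [div_lt_iff₀ hq']; linarith
        have h7 : X / 4 / q = X / q / 4 := by ring
        linarith
    have h1 := le_norm_quadSum a b hq ha heven hodd L N
    have h2 : X / Real.sqrt q / 8 ≤ (N / q : ℕ) * Real.sqrt q := by
      calc X / Real.sqrt q / 8 = X / q / 8 * Real.sqrt q := by
            rw [← hdiv]; ring
        _ ≤ _ := by gcongr
    linarith
  · intro k hk
    refine (norm_quadSum_le a b hq ha heven hodd L k).trans ?_
    have h1 : (k : ℝ) / Real.sqrt q ≤ 2 * (X / Real.sqrt q) := by
      rw [← mul_div_assoc]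
      gcongr
      exact le_trans (by exact_mod_cast hk) hN2
    linarith

theorem le_norm_evolve_datumOther {φ : ℝ → ℝ} (hφ : IsProfile φ) {R D : ℝ} (hR : 1 ≤ R)
    (hD : 0 < D) (hl : ∃ l : ℤ, R / (2 * D) < (l : ℝ) ∧ (l : ℝ) < R / D) {q : ℕ} (hq : 0 < q)
    (hK : 64 * Real.sqrt (Real.log q) ≤ R / (D * q)) {a b : ℤ} (ha : IsCoprime a q)
    (heven : q % 4 = 0 → Even b) (hodd : q % 4 = 2 → Odd b) {t x c₀ : ℝ}
    (hc₀ : 6080 * Real.pi * (∫ y, φ y) * c₀ ≤ 1)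
    (ht : t = 2 * a / (D ^ 2 * q)) (ht0 : 0 ≤ t) (htR : t ≤ c₀ / R) (hx : |x| ≤ c₀)
    (hxb : |x - b / (D * q)| ≤ c₀ * R⁻¹) :
    R / D / Real.sqrt q / 32 ≤ ‖evolve t (datumOther φ R D) x‖ := by
  have hR0 : 0 < R := by linarith
  have hpi := Real.pi_pos
  obtain ⟨hX, -, hN, hLN⟩ := card_freqs_bounds hR0 hD hl
  obtain ⟨hlow, hM⟩ := quadSum_freqs_bounds hR0 hD hl hq hK ha heven hodd (⌊R / (2 * D)⌋ + 1)
  set L := ⌊R / (2 * D)⌋ + 1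
  set N := (freqs R D).card
  set Y := R / D / Real.sqrt q
  set S := quadSum a b q L N
  have hY : 0 ≤ Y := by positivity
  have hc0 : 0 ≤ c₀ := (abs_nonneg x).trans hx
  rw [evolve_datumOther hφ]
  simp only [sum_freqs_eq_quadPhase hD hq a b ht]
  set T : ℝ → ℂ := fun η => ∑ k ∈ Finset.range N, quadPhase a b q (L + k) *
    e ((L + k : ℤ) * (2 * Real.pi * D * (x - b / (D * q) - t * η))) with hT
  have hTcont : Continuous T :=
    continuous_finsetSum _ fun k _ => continuous_const.mul (continuous_e.comp (by fun_prop))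
  have h := hφ.norm_integral_hat_mul_sub_le
    (F := fun η => e (-Real.pi * t * η ^ 2 + 2 * Real.pi * (x * η)) * T η)
    ((continuous_e.comp (by fun_prop)).mul hTcont) (z := S) (ε := 95 * Real.pi * c₀ * Y) ?_
  · have h2 := norm_sub_norm_le S (∫ η, profileHat φ η *
      (e (-Real.pi * t * η ^ 2 + 2 * Real.pi * (x * η)) * T η))
    rw [norm_sub_rev] at h2
    have h3 : 2 * (∫ y, φ y) * (95 * Real.pi * c₀ * Y) ≤ Y / 32 := by
      have := mul_le_mul_of_nonneg_right hc₀ hY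
      linarith
    linarith
  · intro η hη
    have htwist : ‖T η - S‖ ≤ 80 * Real.pi * c₀ * Y := by
      have h1 := norm_quadSum_twist_sub_le a b q L N
        (θ := 2 * Real.pi * D * (x - b / (D * q) - t * η)) hM
      refine h1.trans ?_
      have hθ : |2 * Real.pi * D * (x - b / (D * q) - t * η)| ≤ 4 * Real.pi * c₀ * (D / R) := by
        rw [abs_mul, abs_of_pos (by positivity : 0 < 2 * Real.pi * D)]
        have h2 : |x - b / (D * q) - t * η| ≤ c₀ * R⁻¹ + c₀ * R⁻¹ := by
          refine (abs_sub _ _).trans (add_le_add hxb ?_)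
          rw [abs_mul, abs_of_nonneg ht0]
          calc t * |η| ≤ t * 1 := by gcongr
            _ ≤ c₀ * R⁻¹ := by rw [mul_one]; exact htR
        calc 2 * Real.pi * D * |x - b / (D * q) - t * η| ≤
            2 * Real.pi * D * (c₀ * R⁻¹ + c₀ * R⁻¹) := by gcongr
          _ = 4 * Real.pi * c₀ * (D / R) := by ring
      calc 5 * Y * ((N + |((L + N : ℤ) : ℝ)|) *
            |2 * Real.pi * D * (x - b / (D * q) - t * η)|) ≤
          5 * Y * ((2 * (R / D) + 2 * (R / D)) * (4 * Real.pi * c₀ * (D / R))) := by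
            gcongr
        _ = 80 * Real.pi * c₀ * Y := by field_simp; ring
    have hphase : ‖e (-Real.pi * t * η ^ 2 + 2 * Real.pi * (x * η)) - 1‖ ≤
        3 * Real.pi * c₀ := by
      refine (norm_e_sub_one_le _).trans ((abs_add_le _ _).trans ?_)
      have htc : t ≤ c₀ := htR.trans (div_le_self hc0 hR)
      have h1 : |-Real.pi * t * η ^ 2| ≤ Real.pi * c₀ := by
        rw [abs_mul, abs_mul, abs_neg, abs_of_pos hpi, abs_of_nonneg ht0, abs_pow]
        have : |η| ^ 2 ≤ 1 := pow_le_one₀ (abs_nonneg _) hη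
        calc Real.pi * t * |η| ^ 2 ≤ Real.pi * t * 1 := by gcongr
          _ ≤ Real.pi * c₀ := by rw [mul_one]; gcongr
      have h2 : |2 * Real.pi * (x * η)| ≤ 2 * Real.pi * c₀ := by
        rw [abs_mul, abs_of_pos (by positivity : 0 < 2 * Real.pi), abs_mul]
        refine mul_le_mul_of_nonneg_left ?_ (by positivity)
        calc |x| * |η| ≤ |x| * 1 := by gcongr
          _ ≤ c₀ := by rw [mul_one]; exact hx
      linarith
    set E := e (-Real.pi * t * η ^ 2 + 2 * Real.pi * (x * η)) with hE
    calc ‖E * T η - S‖ = ‖E * (T η - S) + (E - 1) * S‖ := by congr 1; ring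
      _ ≤ ‖E * (T η - S)‖ + ‖(E - 1) * S‖ := norm_add_le _ _
      _ = ‖T η - S‖ + ‖E - 1‖ * ‖S‖ := by rw [norm_mul, norm_mul, hE, norm_e, one_mul]
      _ ≤ 80 * Real.pi * c₀ * Y + 3 * Real.pi * c₀ * (5 * Y) :=
          add_le_add htwist (mul_le_mul hphase (hM N le_rfl) (norm_nonneg _) (by positivity))
      _ = 95 * Real.pi * c₀ * Y := by ring

/-! ### The lower bound for the datum -/

/-- The one-dimensional factors of the datum. -/
noncomputable def datumFactor {m : ℕ} (φ : ℝ → ℝ) (R D : ℝ) : Fin (m + 1) → ℝ → ℂ :=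
  Fin.cons (datumFirst φ R) fun _ => datumOther φ R D

theorem bourgainDatum_eq_prod {m : ℕ} (φ : ℝ → ℝ) (R D : ℝ) :
    bourgainDatum (m := m) φ R D = fun x => ∏ i, datumFactor φ R D i (x i) := by
  ext x
  rw [bourgainDatum, Fin.prod_univ_succ]
  rfl

theorem schrodinger_bourgainDatum {m : ℕ} (φ : ℝ → ℝ) (R D t : ℝ)
    (x : EuclideanSpace ℝ (Fin (m + 1))) :
    schrodinger t (bourgainDatum φ R D) x =
      evolve t (datumFirst φ R) (x 0) * ∏ j : Fin m, evolve t (datumOther φ R D) (x j.succ) := by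
  rw [bourgainDatum_eq_prod, schrodinger_euclidean_prod, Fin.prod_univ_succ]
  rfl

theorem normL2_bourgainDatum_sq {m : ℕ} {φ : ℝ → ℝ} (hφ : IsProfile φ) {R D : ℝ} (hR : 0 < R)
    (hD : 2 < D) :
    normL2 (bourgainDatum (m := m) φ R D) ^ 2 =
      (Real.sqrt R)⁻¹ * (∫ y, φ y ^ 2) * ((freqs R D).card * ∫ y, φ y ^ 2) ^ m := by
  rw [bourgainDatum_eq_prod, normL2_euclidean_prod, Fin.prod_univ_succ]
  · simp only [datumFactor, Fin.cons_zero, Fin.cons_succ, integral_norm_datumFirst_sq φ hR,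
      integral_norm_datumOther_sq hφ R hD, Finset.prod_const, Finset.card_univ, Fintype.card_fin]
  · intro i
    refine Fin.cases ?_ (fun j => ?_) i
    · exact continuous_datumFirst hφ R
    · exact continuous_datumOther hφ R D
  · intro i
    refine Fin.cases ?_ (fun j => ?_) i
    · exact integrable_norm_datumFirst_sq hφ hR
    · exact integrable_norm_datumOther_sq hφ R D

/-- Positive times `2 a / (D² q) ≤ 1 / (2 R)` force the frequency spacing `D` to be large: for
`q = 1` because `R > D`, for `q ≥ 2` because `R ≥ D q`. -/
theorem four_le_of_time_le {R D : ℝ} (hR : 0 < R) (hD : 0 < D) (hX : 1 < R / D) {q : ℕ}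
    (hq : 0 < q) (hK : 64 * Real.sqrt (Real.log q) ≤ R / (D * q)) {a : ℤ} {t : ℝ}
    (ht : t = 2 * a / (D ^ 2 * q)) (ht0 : 0 < t) (htR : t ≤ 1 / 2 / R) : 4 ≤ D := by
  have hq' : (0 : ℝ) < q := by exact_mod_cast hq
  have hDq : 0 < D ^ 2 * q := by positivity
  have ha : (1 : ℝ) ≤ a := by
    have h1 : (0 : ℝ) < a := by
      rw [ht, div_pos_iff_of_pos_right hDq] at ht0; linarith
    have h2 : (0 : ℤ) < a := by exact_mod_cast h1
    exact_mod_cast h2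
  have h1 : 4 * R ≤ D ^ 2 * q := by
    rw [ht, div_le_div_iff₀ hDq hR] at htR
    nlinarith
  have h2 : D * q ≤ R := by
    rcases Nat.lt_or_ge q 2 with h | h
    · obtain rfl : q = 1 := by omega
      rw [one_lt_div hD] at hX
      simpa using hX.le
    · have h1 : Real.log 2 ≤ Real.log q := Real.log_le_log two_pos (by exact_mod_cast h)
      have h2 : (1 / 2 : ℝ) ≤ Real.sqrt (Real.log q) :=
        Real.le_sqrt_of_sq_le (by linarith [Real.log_two_gt_d9])
      have h3 : (1 : ℝ) ≤ R / (D * q) := by linarith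
      rwa [one_le_div (by positivity)] at h3
  have h3 : D * q * 4 ≤ D * q * D := by nlinarith
  exact le_of_mul_le_mul_left h3 (by positivity)

theorem theorem2 (m : ℕ) (φ : ℝ → ℝ) (hφ : IsProfile φ) :
    ∃ c₀ > (0 : ℝ), ∃ K > (0 : ℝ), ∃ C > (0 : ℝ),
      ∀ c : ℝ, 0 < c → c ≤ c₀ →
      ∀ R D : ℝ, 0 < R → 0 < D →
      (∃ l : ℤ, R / (2 * D) < (l : ℝ) ∧ (l : ℝ) < R / D) →
      ∀ q : ℕ, 0 < q → K * Real.sqrt (Real.log q) ≤ R / (D * q) →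
      ∀ p : Fin (m + 1) → ℤ, IsAdmissible p q →
      ∀ t : ℝ, t = 2 * p 0 / (D ^ 2 * q) → 0 < t → t ≤ c₀ / R →
      ∀ x ∈ slab c R D q p ∩ cube c,
        C * (R ^ (1 / 4 : ℝ) * (R / (D * q)) ^ ((m : ℝ) / 2)) ≤
          ‖schrodinger t (bourgainDatum (m := m) φ R D) x‖ /
            normL2 (bourgainDatum (m := m) φ R D) := by
  set A := ∫ y, φ y with hA
  set P := ∫ y, φ y ^ 2 with hP
  have hA0 : 0 ≤ A := integral_nonneg hφ.nonneg
  have hP0 : 0 < P := hφ.integral_sq_pos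
  have hpi := Real.pi_pos
  have hden : 0 < 2 + 6080 * Real.pi * A := by positivity
  have hQ : 0 < P * (2048 * P) ^ m := by positivity
  -- `c₀` is small enough for the perturbations of both kinds of factors, and at most `1 / 2`
  refine ⟨1 / (2 + 6080 * Real.pi * A), by positivity, 64, by norm_num,
    1 / (2 * Real.sqrt (P * (2048 * P) ^ m)), by positivity, ?_⟩
  intro c hc hcc R D hR hD hl q hq hK p hp t ht ht0 htR x ⟨⟨hx0, hxs⟩, hxc⟩
  set c₀ := 1 / (2 + 6080 * Real.pi * A) with hc₀
  have hc₀0 : 0 < c₀ := by positivity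
  have hc₀half : c₀ ≤ 1 / 2 := by
    rw [hc₀]; gcongr; linarith [show 0 ≤ 6080 * Real.pi * A by positivity]
  have hc₀A : 6080 * Real.pi * A * c₀ ≤ 1 := by
    rw [hc₀, mul_one_div, div_le_one hden]; linarith
  obtain ⟨hX, -, hN, -⟩ := card_freqs_bounds hR hD hl
  have hq' : (0 : ℝ) < q := by exact_mod_cast hq
  have hD4 : 4 ≤ D := four_le_of_time_le hR hD hX hq hK ht ht0
    (htR.trans (div_le_div_of_nonneg_right hc₀half hR.le))
  have hR1 : 1 ≤ R := by
    rw [one_lt_div hD] at hX; linarith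
  -- the first factor
  have hfirst : 1 / 2 ≤ ‖evolve t (datumFirst φ R) (x 0)‖ := by
    refine half_le_norm_evolve_datumFirst hφ hR (c₀ := c₀) ?_ ?_ ?_
    · have : 0 ≤ Real.pi * A * c₀ := by positivity
      rw [← hA]; linarith
    · rw [abs_of_pos (by positivity)]
      rwa [le_div_iff₀ hR] at htR
    · have h1 : t * R = 2 * (p 0 * R / (q * D ^ 2)) := by rw [ht]; field_simp
      have h2 : R ^ (-(1 / 2) : ℝ) = (Real.sqrt R)⁻¹ := by
        rw [Real.rpow_neg hR.le, Real.sqrt_eq_rpow]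
      rw [h1]
      have hs : 0 < Real.sqrt R := Real.sqrt_pos.2 hR
      rw [h2] at hx0
      calc _ ≤ Real.sqrt R * (c * (Real.sqrt R)⁻¹) := by gcongr
        _ = c := by field_simp
        _ ≤ c₀ := hcc
  -- the other factors
  have hother : ∀ j : Fin m,
      R / D / Real.sqrt q / 32 ≤ ‖evolve t (datumOther φ R D) (x j.succ)‖ := by
    intro j
    refine le_norm_evolve_datumOther hφ hR1 hD hl hq hK hp.coprime (fun h => hp.even h j)
      (fun h => hp.odd h j) hc₀A ht ht0.le htR ?_ ?_
    · rw [abs_of_nonneg (hxc j.succ).1]; exact (hxc j.succ).2.trans hcc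
    · exact (hxs j).trans (by gcongr)
  set Y := R / D / Real.sqrt q with hY
  have hY0 : 0 ≤ Y := by positivity
  have hnum : 1 / 2 * (Y / 32) ^ m ≤ ‖schrodinger t (bourgainDatum (m := m) φ R D) x‖ := by
    rw [schrodinger_bourgainDatum, norm_mul, norm_prod]
    refine mul_le_mul hfirst ?_ (by positivity) (norm_nonneg _)
    calc (Y / 32) ^ m = ∏ _j : Fin m, Y / 32 := by
          rw [Finset.prod_const, Finset.card_univ, Fintype.card_fin]
      _ ≤ _ := Finset.prod_le_prod (fun _ _ => by positivity) fun j _ => hother j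
  have hsq := normL2_bourgainDatum_sq (m := m) hφ hR (D := D) (by linarith)
  have hcard : (0 : ℝ) < (freqs R D).card := by
    obtain ⟨l, hl⟩ := hl
    exact_mod_cast Finset.card_pos.2 ⟨l, (mem_freqs R D l).2 hl⟩
  set n := normL2 (bourgainDatum (m := m) φ R D) with hn
  have hs : 0 < Real.sqrt R := Real.sqrt_pos.2 hR
  have hn0 : 0 < n := by
    have h1 : 0 ≤ n := ENNReal.toReal_nonneg
    have h2 : 0 < n ^ 2 := by rw [hsq]; positivity
    exact lt_of_le_of_ne h1 fun h => by rw [← h] at h2; norm_num at h2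
  have hn2 : n ^ 2 ≤ (Real.sqrt R)⁻¹ * P * (2 * (R / D) * P) ^ m := by
    rw [hsq]; gcongr
  rw [le_div_iff₀ hn0]
  refine le_trans ?_ hnum
  -- compare squares
  refine abs_le_of_sq_le_sq' ?_ (by positivity) |>.2
  have hRq : (R ^ (1 / 4 : ℝ)) ^ 2 = Real.sqrt R := by
    rw [← Real.rpow_natCast, ← Real.rpow_mul hR.le, Real.sqrt_eq_rpow]; norm_num
  have hW0 : 0 ≤ R / (D * q) := by positivity
  have hWm : ((R / (D * q)) ^ ((m : ℝ) / 2)) ^ 2 = (R / (D * q)) ^ m := by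
    rw [← Real.rpow_natCast, ← Real.rpow_mul hW0, ← Real.rpow_natCast]
    congr 1; push_cast; ring
  have hY2 : Y ^ 2 = R / D * (R / (D * q)) := by
    rw [hY, div_pow, Real.sq_sqrt hq'.le]; field_simp
  calc (1 / (2 * Real.sqrt (P * (2048 * P) ^ m)) *
        (R ^ (1 / 4 : ℝ) * (R / (D * q)) ^ ((m : ℝ) / 2)) * n) ^ 2
      = 1 / (4 * Real.sqrt (P * (2048 * P) ^ m) ^ 2) *
          ((R ^ (1 / 4 : ℝ)) ^ 2 * ((R / (D * q)) ^ ((m : ℝ) / 2)) ^ 2) * n ^ 2 := by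
        ring
    _ = 1 / (4 * (P * (2048 * P) ^ m)) * (Real.sqrt R * (R / (D * q)) ^ m) * n ^ 2 := by
        rw [Real.sq_sqrt hQ.le, hRq, hWm]
    _ ≤ 1 / (4 * (P * (2048 * P) ^ m)) * (Real.sqrt R * (R / (D * q)) ^ m) *
        ((Real.sqrt R)⁻¹ * P * (2 * (R / D) * P) ^ m) := by gcongr
    _ = 1 / 4 * ((R / (D * q)) ^ m * (2 * (R / D) * P) ^ m / (2048 * P) ^ m) := by
        field_simp
    _ = 1 / 4 * ((Y / 32) ^ 2) ^ m := by
        rw [← mul_pow, ← div_pow, div_pow Y, hY2]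
        congr 2; field_simp; norm_num
    _ = (1 / 2 * (Y / 32) ^ m) ^ 2 := by rw [← pow_mul, mul_comm 2 m, pow_mul]; ring
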